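/- Let $d,n\ge 1$ be integers, let $r>1$ be real, put $q=2n$, and let $\mu$ be the normalized Lebesgue measure $(2\pi)^{-d}d\mathbf x$ on $[0,2\pi]^d$. Let $\mathbf E^r$ be the Korobov class of all continuous functions $f:\mathbb R^d\to\mathbb C$, $2\pi$-periodic in each variable, such that $$|\hat f(\mathbf k)|\le \prod_{j=1}^d \max(|k_j|,1)^{-r}\quad\text{for all }\mathbf k\in\mathbb Z^d,\qquad \hat f(\mathbf k):=(2\pi)^{-d}\int_{[0,2\pi]^d} f(\mathbf x)e^{-i(\mathbf k,\mathbf x)}\,d\mathbf x .$$ For a class $W$ of continuous functions, define the optimal error of weighted discretization of the $L_q$ norm with $m$ points by $$er_m^o(W,L_q):=\inf_{\xi^1,\dots,\xi^m\in[0,2\pi]^d;\ \lambda_1,\dots,\lambda_m\in\mathbb R}\ \sup_{f\in W}\left|\int_{[0,2\pi]^d}|f|^q\,d\mu-\sum_{j=1}^m\lambda_j|f(\xi^j)|^q\right| .$$ Then $er_m^o(\mathbf E^r,L_q)\asymp m^{-r}(\log m)^{d-1}$; that is, there are constants $c,C>0$ depending only on $r$, $d$ and $n$ such that for every integer $m\ge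 2$ $$c\,m^{-r}(\log m)^{d-1}\le er_m^o(\mathbf E^r,L_q)\le C\,m^{-r}(\log m)^{d-1}.$$ The same two bounds hold when $\mathbf E^r$ is replaced by its subclass of real-valued functions. -/

import Mathlib

open scoped ENNReal BigOperators

/-- The cube `[0, 2π]^d`. -/
def torusCube (d : ℕ) : Set (Fin d → ℝ) :=
  Set.univ.pi fun _ => Set.Icc (0 : ℝ) (2 * Real.pi)

/-- Lebesgue measure on `[0, 2π]^d`, normalized to total mass one, that is
`(2π)^(-d) dx` on the cube. -/
noncomputable def torusMeasure (d : ℕ) : MeasureTheory.Measure (Fin d → ℝ) :=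
  ProbabilityTheory.cond MeasureTheory.volume (torusCube d)

/-- The Fourier coefficient `(2π)^(-d) ∫_{[0,2π]^d} f(x) exp(-i (k, x)) dx`. -/
noncomputable def torusFourierCoeff {d : ℕ} (f : (Fin d → ℝ) → ℂ) (k : Fin d → ℤ) : ℂ :=
  ∫ x, f x * Complex.exp (-(Complex.I * ((∑ j, (k j : ℝ) * x j : ℝ) : ℂ))) ∂(torusMeasure d)

/-- The Korobov class `E^r` of continuous complex-valued functions on `ℝ^d`, `2π`-periodic in each
variable, with `|f^(k)| ≤ ∏ j, max(|k_j|, 1)^(-r)` for every frequency `k`. -/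
def korobovClass (d : ℕ) (r : ℝ) : Set ((Fin d → ℝ) → ℂ) :=
  {f | Continuous f ∧
    (∀ (x : Fin d → ℝ) (j : Fin d), f (Function.update x j (x j + 2 * Real.pi)) = f x) ∧
    ∀ k : Fin d → ℤ, ‖torusFourierCoeff f k‖ ≤ ∏ j, (max |(k j : ℝ)| 1) ^ (-r)}

/-- The subclass of the real-valued functions of `E^r`. -/
def realKorobovClass (d : ℕ) (r : ℝ) : Set ((Fin d → ℝ) → ℂ) :=
  {f | f ∈ korobovClass d r ∧ ∀ x, (f x).im = 0}

/-- The optimal error `er_m^o(W, L_q)` of weighted discretization, with `m` points of `Ω`, of the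
`q`-th power of the `L_q(Ω, μ)` norm (`1 ≤ q < ∞`, `μ` a measure carried by `Ω`). The infimum over
points and real weights and the supremum over the class are taken in `[0, ∞]`. -/
noncomputable def weightedDiscretizationError {α : Type*} [MeasurableSpace α]
    (Ω : Set α) (μ : MeasureTheory.Measure α) (W : Set (α → ℂ)) (q : ℝ) (m : ℕ) : ℝ≥0∞ :=
  ⨅ (ξ : Fin m → α) (_ : ∀ j, ξ j ∈ Ω) (w : Fin m → ℝ),
    ⨆ f ∈ W, ENNReal.ofReal |(∫ x, ‖f x‖ ^ q ∂μ) - ∑ j, w j * ‖f (ξ j)‖ ^ q|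

open Polynomial in
/-- The polynomial `∏_{i<d} (X - 4 i) - 1`, which is irreducible with `d` distinct real roots. -/
noncomputable def frolovPoly (d : ℕ) : ℤ[X] :=
  ∏ i : Fin d, (X - C (4 * (i : ℤ))) - 1

section FrolovPolynomial

open Polynomial

theorem frolovPoly_natDegree_prod (d : ℕ) :
    (∏ i : Fin d, (X - C (4 * (i : ℤ)))).natDegree = d := by
  rw [natDegree_prod_of_monic _ (fun i : Fin d => X - C (4 * (i : ℤ)))
    (fun i _ => monic_X_sub_C _)]
  simp only [natDegree_X_sub_C, Finset.sum_const, Finset.card_univ, Fintype.card_fin, smul_eq_mul,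
    mul_one]

theorem frolovPoly_monic {d : ℕ} (hd : 1 ≤ d) : (frolovPoly d).Monic := by
  refine Monic.sub_of_left (monic_prod_of_monic _ _ fun i _ => monic_X_sub_C _) ?_
  rw [degree_one, degree_eq_natDegree
    (monic_prod_of_monic _ _ fun i _ => monic_X_sub_C _).ne_zero, frolovPoly_natDegree_prod]
  exact_mod_cast hd

theorem frolovPoly_natDegree {d : ℕ} (hd : 1 ≤ d) : (frolovPoly d).natDegree = d := by
  rw [frolovPoly, natDegree_sub_eq_left_of_natDegree_lt] <;> rw [frolovPoly_natDegree_prod]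
  rw [natDegree_one]
  exact hd

theorem frolovPoly_eval_int {d : ℕ} (i : Fin d) : (frolovPoly d).eval (4 * (i : ℤ)) = -1 := by
  simp only [frolovPoly, eval_sub, eval_prod, eval_one, eval_X, eval_C]
  rw [Finset.prod_eq_zero (Finset.mem_univ i) (by simp)]
  norm_num

theorem frolovPoly_aeval {d : ℕ} (x : ℝ) :
    aeval x (frolovPoly d) = ∏ i : Fin d, (x - 4 * (i : ℝ)) - 1 := by
  simp only [frolovPoly, map_sub, map_prod, aeval_X, aeval_C, map_one]
  simp

theorem two_le_abs_prod_sub {d : ℕ} (hd : 1 ≤ d) (a : ℤ) :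
    2 ≤ |∏ i : Fin d, ((4 * a + 2 : ℝ) - 4 * (i : ℝ))| := by
  rw [Finset.abs_prod]
  calc (2 : ℝ) ≤ 2 ^ d := by simpa using pow_le_pow_right₀ (by norm_num : (1 : ℝ) ≤ 2) hd
    _ = ∏ i : Fin d, (2 : ℝ) := by simp
    _ ≤ _ := by
      refine Finset.prod_le_prod (fun _ _ => by norm_num) fun i _ => ?_
      have h : (2 : ℤ) ≤ |4 * a + 2 - 4 * (i : ℤ)| := by
        rcases abs_cases (4 * a + 2 - 4 * (i : ℤ)) with h | h <;> omega
      exact_mod_cast h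

theorem exists_frolovPoly_root {d : ℕ} (hd : 1 ≤ d) (i : Fin d) :
    ∃ x : ℝ, aeval x (frolovPoly d) = 0 ∧ 4 * (i : ℝ) - 2 < x ∧ x < 4 * (i : ℝ) + 2 := by
  set Q : ℝ → ℝ := fun x => ∏ i : Fin d, (x - 4 * (i : ℝ)) with hQ
  have hQc : Continuous Q := by fun_prop
  have h1 : 2 ≤ |Q (4 * (i : ℝ) - 2)| := by
    have := two_le_abs_prod_sub hd ((i : ℤ) - 1)
    push_cast at this
    convert this using 5
    ring
  have h2 : 2 ≤ |Q (4 * (i : ℝ) + 2)| := by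
    have := two_le_abs_prod_sub hd (i : ℤ)
    push_cast at this
    exact this
  have h3 : Q (4 * (i : ℝ) - 2) * Q (4 * (i : ℝ) + 2) < 0 := by
    simp only [hQ]
    rw [← Finset.prod_mul_distrib, ← Finset.mul_prod_erase _ _ (Finset.mem_univ i)]
    refine mul_neg_of_neg_of_pos (by ring_nf; norm_num) (Finset.prod_pos fun j hj => ?_)
    have hij : ((i : ℕ) : ℤ) ≠ (j : ℕ) := fun h =>
      (Finset.ne_of_mem_erase hj) (Fin.ext (by exact_mod_cast h.symm))
    have h : (1 : ℤ) ≤ ((i : ℤ) - j) ^ 2 := by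
      have : ((i : ℤ) - j) ≠ 0 := sub_ne_zero.2 hij
      have := sq_pos_of_ne_zero this
      omega
    have h' : (1 : ℝ) ≤ ((i : ℝ) - j) ^ 2 := by exact_mod_cast h
    nlinarith
  have hle : 4 * (i : ℝ) - 2 ≤ 4 * (i : ℝ) + 2 := by linarith
  obtain ⟨x, hx, hx1⟩ : (1 : ℝ) ∈ Q '' Set.Ioo (4 * (i : ℝ) - 2) (4 * (i : ℝ) + 2) := by
    rcases mul_neg_iff.1 h3 with ⟨ha, hb⟩ | ⟨ha, hb⟩
    · rw [abs_of_pos ha] at h1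
      exact intermediate_value_Ioo' hle hQc.continuousOn ⟨by linarith, by linarith⟩
    · rw [abs_of_pos hb] at h2
      exact intermediate_value_Ioo hle hQc.continuousOn ⟨by linarith, by linarith⟩
  exact ⟨x, by rw [frolovPoly_aeval]; simp only [hQ] at hx1; rw [hx1, sub_self], hx⟩

/-- A nonzero integer polynomial of degree less than `d` does not vanish at a root of
`frolovPoly d`. -/
theorem aeval_ne_zero_of_frolovPoly_root {d : ℕ} (hd : 1 ≤ d) {x : ℝ}
    (hx : aeval x (frolovPoly d) = 0) {q : ℤ[X]} (hq : q ≠ 0) (hqd : q.natDegree < d) :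
    aeval x q ≠ 0 := by
  intro hqx
  have hint : IsIntegral ℤ x := ⟨frolovPoly d, frolovPoly_monic hd, hx⟩
  set g := minpoly ℤ x
  have hgm : g.Monic := minpoly.monic hint
  have hgq : g ∣ q := minpoly.isIntegrallyClosed_dvd hint hqx
  have hgd : g.natDegree < d := (natDegree_le_of_dvd hgq hq).trans_lt hqd
  have hg1 : 0 < g.natDegree := minpoly.natDegree_pos hint
  obtain ⟨h, hh⟩ : g ∣ frolovPoly d := minpoly.isIntegrallyClosed_dvd hint hx
  have hhm : h.Monic := hgm.of_mul_monic_left (hh ▸ frolovPoly_monic hd)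
  have hdeg : g.natDegree + h.natDegree = d := by
    rw [← hgm.natDegree_mul hhm, ← hh, frolovPoly_natDegree hd]
  have hsum : g + h = 0 := by
    refine eq_zero_of_natDegree_lt_card_of_eval_eq_zero (g + h)
      (f := fun i : Fin d => 4 * (i : ℤ)) (fun i j hij => ?_) (fun i => ?_) ?_
    · have : 4 * (i : ℤ) = 4 * (j : ℤ) := hij
      exact Fin.ext (by omega)
    · have h1 := frolovPoly_eval_int i
      rw [hh, eval_mul] at h1
      have h2 := Int.eq_one_or_neg_one_of_mul_eq_neg_one h1
      rw [eval_add]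
      rcases h2 with h2 | h2 <;> rw [h2] at h1 ⊢ <;> linarith
    · rw [Fintype.card_fin]
      exact (natDegree_add_le _ _).trans_lt (max_lt hgd (by omega))
  have hneg : h = -g := eq_neg_of_add_eq_zero_right hsum
  have hlc : h.leadingCoeff = -1 := by rw [hneg, leadingCoeff_neg, hgm.leadingCoeff]
  rw [hhm.leadingCoeff] at hlc
  norm_num at hlc

end FrolovPolynomial

open Polynomial in
/-- There is a full lattice in `ℝ^d` whose nonzero points have coordinate product at least one in
absolute value. -/
theorem exists_admissible_matrix {d : ℕ} (hd : 1 ≤ d) :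
    ∃ B : Matrix (Fin d) (Fin d) ℝ, B.det ≠ 0 ∧
      ∀ w : Fin d → ℤ, w ≠ 0 → 1 ≤ ∏ i, |∑ j, B i j * (w j : ℝ)| := by
  choose ξ hξ hl hu using exists_frolovPoly_root hd
  have hinj : Function.Injective ξ := by
    intro i j hij
    have h1 := hl i
    have h2 := hu i
    have h3 := hl j
    have h4 := hu j
    rw [hij] at h1 h2
    have h5 : ((4 * i : ℕ) : ℝ) < ((4 * j + 4 : ℕ) : ℝ) := by push_cast; linarith
    have h6 : ((4 * j : ℕ) : ℝ) < ((4 * i + 4 : ℕ) : ℝ) := by push_cast; linarith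
    have h5' := Nat.cast_lt.1 h5
    have h6' := Nat.cast_lt.1 h6
    exact Fin.ext (by omega)
  refine ⟨Matrix.vandermonde ξ, Matrix.det_vandermonde_ne_zero_iff.2 hinj, fun w hw => ?_⟩
  set q : ℤ[X] := ∑ j : Fin d, C (w j) * X ^ (j : ℕ) with hqdef
  have hcoeff : ∀ i : Fin d, q.coeff i = w i := by
    intro i
    simp only [hqdef, finsetSum_coeff, coeff_C_mul, coeff_X_pow]
    rw [Finset.sum_eq_single i] <;> simp +contextual [Fin.ext_iff, eq_comm]
  have hq : q ≠ 0 := by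
    rintro h
    apply hw
    ext i
    rw [← hcoeff i, h]
    simp
  have hqd : q.natDegree < d := by
    refine (natDegree_lt_iff_degree_lt hq).2 ((degree_sum_le _ _).trans_lt ?_)
    rw [Finset.sup_lt_iff (by exact_mod_cast WithBot.bot_lt_coe d)]
    intro j _
    exact (degree_C_mul_X_pow_le _ _).trans_lt (by exact_mod_cast j.2)
  have hval : ∀ i, aeval (ξ i) q = ∑ j, Matrix.vandermonde ξ i j * (w j : ℝ) := by
    intro i
    simp [hqdef, Matrix.vandermonde_apply, mul_comm]
  have hmon : ((frolovPoly d).map (algebraMap ℤ ℝ)).Monic := (frolovPoly_monic hd).map _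
  have hprod : (frolovPoly d).map (algebraMap ℤ ℝ) = ∏ i, (X - C (ξ i)) := by
    refine eq_of_monic_of_dvd_of_natDegree_le
      (monic_prod_of_monic _ _ fun i _ => monic_X_sub_C (ξ i)) hmon ?_ ?_
    · refine Finset.prod_dvd_of_coprime (fun i _ j _ hij => ?_) fun i _ => ?_
      · exact pairwise_coprime_X_sub_C hinj hij
      · rw [dvd_iff_isRoot, IsRoot.def, eval_map_algebraMap, hξ]
    · rw [(frolovPoly_monic hd).natDegree_map, frolovPoly_natDegree hd,
        natDegree_prod_of_monic _ _ (fun i _ => monic_X_sub_C (ξ i))]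
      simp
  have hroots : ((frolovPoly d).map (algebraMap ℤ ℝ)).roots = Finset.univ.val.map ξ := by
    rw [hprod, ← Polynomial.roots_multiset_prod_X_sub_C (Finset.univ.val.map ξ), Multiset.map_map]
    rfl
  have hsplits : ((frolovPoly d).map (algebraMap ℤ ℝ)).Splits := by
    rw [hprod]
    exact Splits.prod fun i _ => Splits.X_sub_C _
  have hres := resultant_eq_prod_eval ((frolovPoly d).map (algebraMap ℤ ℝ))
    (q.map (algebraMap ℤ ℝ)) q.natDegree (natDegree_map_le) hsplits
  rw [hmon.leadingCoeff, one_pow, one_mul, hroots, Multiset.map_map, resultant_map_map] at hres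
  have hres' : ((resultant (frolovPoly d) q
      ((frolovPoly d).map (algebraMap ℤ ℝ)).natDegree q.natDegree : ℤ) : ℝ)
      = ∏ i, aeval (ξ i) q := by
    rw [← eq_intCast (algebraMap ℤ ℝ), hres]
    simp only [Function.comp_def, eval_map_algebraMap]
    rfl
  have hne : ∏ i, aeval (ξ i) q ≠ 0 :=
    Finset.prod_ne_zero_iff.2 fun i _ => aeval_ne_zero_of_frolovPoly_root hd (hξ i) hq hqd
  rw [← Finset.abs_prod]
  simp_rw [← hval]
  rw [← hres'] at hne ⊢
  exact_mod_cast Int.one_le_abs (by exact_mod_cast hne)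

section DyadicLevel

/-- The least exponent `s` with `⌊|x|⌋ < 2 ^ s`. -/
noncomputable def dyadicLevel (x : ℝ) : ℕ := Nat.size ⌊|x|⌋₊

theorem abs_lt_two_pow_dyadicLevel (x : ℝ) : |x| < 2 ^ dyadicLevel x := by
  have h : ⌊|x|⌋₊ + 1 ≤ 2 ^ dyadicLevel x := Nat.lt_size_self _
  have h' : ((⌊|x|⌋₊ : ℝ) + 1) ≤ 2 ^ dyadicLevel x := by exact_mod_cast h
  exact (Nat.lt_floor_add_one _).trans_le h'

theorem two_pow_dyadicLevel_le (x : ℝ) : (2 : ℝ) ^ dyadicLevel x ≤ 2 * max |x| 1 := by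
  rcases Nat.eq_zero_or_pos (dyadicLevel x) with h | h
  · rw [h, pow_zero]
    linarith [le_max_right |x| 1]
  · obtain ⟨n, hn⟩ := Nat.exists_eq_succ_of_ne_zero h.ne'
    have h1 : 2 ^ n ≤ ⌊|x|⌋₊ := Nat.lt_size.1 (show n < dyadicLevel x by omega)
    have h2 : (2 : ℝ) ^ n ≤ |x| :=
      le_trans (by exact_mod_cast h1) (Nat.floor_le (abs_nonneg x))
    rw [hn, pow_succ]
    linarith [le_max_left |x| 1]

theorem dyadicLevel_le_of_abs_lt {k : ℤ} {s : ℕ} (h : |(k : ℝ)| < 2 ^ s) :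
    dyadicLevel k ≤ s :=
  Nat.size_le.2 ((Nat.floor_lt (abs_nonneg _)).2 (by exact_mod_cast h))

theorem max_abs_one_le_two_pow_dyadicLevel (x : ℝ) : max |x| 1 ≤ 2 ^ dyadicLevel x :=
  max_le (abs_lt_two_pow_dyadicLevel x).le (one_le_pow₀ (by norm_num))

end DyadicLevel

section Weight

/-- The one-dimensional Korobov weight `max(|x|, 1)^(-r)`. -/
noncomputable def korobovWeight (r x : ℝ) : ℝ := (max |x| 1) ^ (-r)

theorem korobovWeight_pos (r x : ℝ) : 0 < korobovWeight r x :=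
  Real.rpow_pos_of_pos (lt_max_of_lt_right one_pos) _

theorem korobovWeight_neg (r x : ℝ) : korobovWeight r (-x) = korobovWeight r x := by
  simp [korobovWeight]

theorem korobovWeight_zero (r : ℝ) : korobovWeight r 0 = 1 := by
  simp [korobovWeight]

theorem korobovWeight_le_of_le {r c : ℝ} (hr : 0 ≤ r) (hc : 0 < c) {x y : ℝ}
    (h : max |y| 1 ≤ c * max |x| 1) : korobovWeight r x ≤ c ^ r * korobovWeight r y := by
  have hx : 0 < max |x| 1 := lt_max_of_lt_right one_pos
  have hy : 0 < max |y| 1 := lt_max_of_lt_right one_pos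
  have h1 : (c * max |x| 1) ^ (-r) ≤ (max |y| 1) ^ (-r) :=
    Real.rpow_le_rpow_of_nonpos hy h (by linarith)
  rw [Real.mul_rpow hc.le hx.le, Real.rpow_neg hc.le] at h1
  have hcr : 0 < c ^ r := Real.rpow_pos_of_pos hc r
  calc korobovWeight r x = c ^ r * ((c ^ r)⁻¹ * korobovWeight r x) := by field_simp
    _ ≤ c ^ r * korobovWeight r y := mul_le_mul_of_nonneg_left h1 hcr.le

theorem korobovWeight_mul_le {r : ℝ} (hr : 0 ≤ r) (a b : ℝ) :
    korobovWeight r a * korobovWeight r b ≤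
      2 ^ r * korobovWeight r (a + b) * (korobovWeight r a + korobovWeight r b) := by
  have ha := korobovWeight_pos r a
  have hb := korobovWeight_pos r b
  have hab : 0 ≤ (2 : ℝ) ^ r * korobovWeight r (a + b) :=
    mul_nonneg (by positivity) (korobovWeight_pos _ _).le
  have h3 : |a + b| ≤ |a| + |b| := abs_add_le a b
  rcases le_total |a| |b| with h | h
  · have : korobovWeight r b ≤ 2 ^ r * korobovWeight r (a + b) := by
      refine korobovWeight_le_of_le hr two_pos (max_le ?_ ?_)
      · linarith [le_max_left |b| 1]
      · linarith [le_max_right |b| 1]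
    nlinarith
  · have : korobovWeight r a ≤ 2 ^ r * korobovWeight r (a + b) := by
      refine korobovWeight_le_of_le hr two_pos (max_le ?_ ?_)
      · linarith [le_max_left |a| 1]
      · linarith [le_max_right |a| 1]
    nlinarith

theorem summable_korobovWeight_int {r : ℝ} (hr : 1 < r) :
    Summable fun k : ℤ => korobovWeight r k := by
  refine Summable.of_nonneg_of_le (fun k => (korobovWeight_pos r k).le) (fun k => ?_)
    ((Real.summable_abs_int_rpow hr).add
      (summable_of_hasFiniteSupport (f := fun k : ℤ => if k = 0 then (1 : ℝ) else 0)
        ((Set.finite_singleton 0).subset fun k hk => by simpa using hk)))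
  rcases eq_or_ne k 0 with rfl | hk
  · simp only [Int.cast_zero, korobovWeight_zero, if_true]
    linarith [Real.rpow_nonneg (abs_nonneg (0 : ℝ)) (-r)]
  · have : (1 : ℝ) ≤ |(k : ℝ)| := by exact_mod_cast Int.one_le_abs hk
    simp [korobovWeight, hk, max_eq_left this]

theorem exists_tsum_korobovWeight_sub_le {r : ℝ} (hr : 1 < r) :
    ∃ D : ℝ≥0∞, D ≠ ∞ ∧
      ∀ y : ℝ, ∑' k : ℤ, ENNReal.ofReal (korobovWeight r (y - k)) ≤ D := by
  refine ⟨ENNReal.ofReal (2 ^ r) * ∑' k : ℤ, ENNReal.ofReal (korobovWeight r k),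
    ENNReal.mul_ne_top ENNReal.ofReal_ne_top (summable_korobovWeight_int hr).tsum_ofReal_ne_top,
    fun y => ?_⟩
  rw [← (Equiv.addRight ⌊y⌋).tsum_eq, ← ENNReal.tsum_mul_left]
  refine ENNReal.tsum_le_tsum fun k => ?_
  rw [← ENNReal.ofReal_mul (by positivity)]
  refine ENNReal.ofReal_le_ofReal (korobovWeight_le_of_le (by linarith) two_pos ?_)
  have h1 := Int.floor_le y
  have h2 := Int.lt_floor_add_one y
  have h3 : |(k : ℝ)| ≤ |y - ((Equiv.addRight ⌊y⌋ k : ℤ) : ℝ)| + 1 := by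
    simp only [Equiv.coe_addRight, Int.cast_add]
    have : |(k : ℝ)| = |(y - ⌊y⌋) - (y - (k + ⌊y⌋))| := by congr 1; ring
    rw [this]
    refine (abs_sub _ _).trans ?_
    rw [abs_of_nonneg (by linarith : 0 ≤ y - ⌊y⌋)]
    linarith
  have h4 := le_max_left |y - ((Equiv.addRight ⌊y⌋ k : ℤ) : ℝ)| 1
  have h5 := le_max_right |y - ((Equiv.addRight ⌊y⌋ k : ℤ) : ℝ)| 1
  exact max_le (by linarith) (by linarith)

theorem exists_tsum_korobovWeight_conv_le {r : ℝ} (hr : 1 < r) :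
    ∃ D : ℝ≥0∞, D ≠ ∞ ∧ ∀ y : ℝ,
      ∑' k : ℤ, ENNReal.ofReal (korobovWeight r k) * ENNReal.ofReal (korobovWeight r (y - k)) ≤
        D * ENNReal.ofReal (korobovWeight r y) := by
  obtain ⟨D, hD, hle⟩ := exists_tsum_korobovWeight_sub_le hr
  refine ⟨ENNReal.ofReal (2 ^ r) * (D + D), ENNReal.mul_ne_top ENNReal.ofReal_ne_top (by simp [hD]),
    fun y => ?_⟩
  have hpt : ∀ k : ℤ, ENNReal.ofReal (korobovWeight r k) * ENNReal.ofReal (korobovWeight r (y - k))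
      ≤ ENNReal.ofReal (2 ^ r) * ENNReal.ofReal (korobovWeight r y) *
        (ENNReal.ofReal (korobovWeight r (0 - k)) + ENNReal.ofReal (korobovWeight r (y - k))) := by
    intro k
    rw [← ENNReal.ofReal_mul (korobovWeight_pos _ _).le, ← ENNReal.ofReal_mul (by positivity),
      ← ENNReal.ofReal_add (korobovWeight_pos _ _).le (korobovWeight_pos _ _).le,
      ← ENNReal.ofReal_mul (mul_nonneg (by positivity) (korobovWeight_pos _ _).le), zero_sub,
      korobovWeight_neg]
    have := korobovWeight_mul_le (by linarith : 0 ≤ r) (k : ℝ) (y - k)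
    rw [add_sub_cancel] at this
    exact ENNReal.ofReal_le_ofReal this
  refine (ENNReal.tsum_le_tsum hpt).trans ?_
  rw [ENNReal.tsum_mul_left, ENNReal.tsum_add, mul_right_comm]
  gcongr
  · exact hle 0
  · exact hle y

theorem tsum_pi_prod_le {ι κ : Type*} [Fintype ι] (f : ι → κ → ℝ≥0∞) :
    ∑' k : ι → κ, ∏ j, f j (k j) ≤ ∏ j, ∑' a, f j a := by
  classical
  rw [ENNReal.tsum_eq_iSup_sum]
  refine iSup_le fun s => ?_
  calc ∑ k ∈ s, ∏ j, f j (k j)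
      ≤ ∑ k ∈ Fintype.piFinset (fun j => s.image fun k => k j), ∏ j, f j (k j) := by
        refine Finset.sum_le_sum_of_subset fun k hk => ?_
        exact Fintype.mem_piFinset.2 fun j => Finset.mem_image_of_mem _ hk
    _ = ∏ j, ∑ a ∈ s.image (fun k => k j), f j a := by rw [Finset.prod_univ_sum]
    _ ≤ _ := Finset.prod_le_prod' fun j _ => ENNReal.sum_le_tsum _

/-- The `d`-dimensional Korobov weight `∏ j, max(|y_j|, 1)^(-r)`. -/
noncomputable def korobovWeightPi {d : ℕ} (r : ℝ) (y : Fin d → ℝ) : ℝ :=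
  ∏ j, korobovWeight r (y j)

theorem korobovWeightPi_pos {d : ℕ} (r : ℝ) (y : Fin d → ℝ) : 0 < korobovWeightPi r y :=
  Finset.prod_pos fun _ _ => korobovWeight_pos _ _

theorem exists_tsum_korobovWeightPi_conv_le (d : ℕ) {r : ℝ} (hr : 1 < r) :
    ∃ D : ℝ≥0∞, D ≠ ∞ ∧ ∀ y : Fin d → ℝ,
      ∑' k : Fin d → ℤ, ENNReal.ofReal (korobovWeightPi r fun j => (k j : ℝ)) *
        ENNReal.ofReal (korobovWeightPi r fun j => y j - k j) ≤
        D * ENNReal.ofReal (korobovWeightPi r y) := by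
  obtain ⟨D, hD, hle⟩ := exists_tsum_korobovWeight_conv_le hr
  refine ⟨D ^ d, ENNReal.pow_ne_top hD, fun y => ?_⟩
  simp only [korobovWeightPi, ENNReal.ofReal_prod_of_nonneg fun i _ => (korobovWeight_pos r _).le,
    ← Finset.prod_mul_distrib]
  refine (tsum_pi_prod_le fun j (k : ℤ) => ENNReal.ofReal (korobovWeight r k) *
    ENNReal.ofReal (korobovWeight r (y j - k))).trans ?_
  refine (Finset.prod_le_prod' fun j _ => hle (y j)).trans ?_
  simp [Finset.prod_mul_distrib]

theorem summable_korobovWeightPi_int (d : ℕ) {r : ℝ} (hr : 1 < r) :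
    Summable fun k : Fin d → ℤ => korobovWeightPi r fun j => (k j : ℝ) := by
  have h : ∑' k : Fin d → ℤ, ENNReal.ofReal (korobovWeightPi r fun j => (k j : ℝ)) ≠ ∞ := by
    simp only [korobovWeightPi, ENNReal.ofReal_prod_of_nonneg fun i _ => (korobovWeight_pos r _).le]
    refine ne_top_of_le_ne_top ?_ (tsum_pi_prod_le fun _ (k : ℤ) =>
      ENNReal.ofReal (korobovWeight r k))
    exact ENNReal.prod_ne_top fun _ _ => (summable_korobovWeight_int hr).tsum_ofReal_ne_top
  have := ENNReal.summable_toReal h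
  simpa only [ENNReal.toReal_ofReal (korobovWeightPi_pos _ _).le] using this

theorem korobovWeight_le_dyadic {r : ℝ} (hr : 0 ≤ r) (x : ℝ) :
    korobovWeight r x ≤ 2 ^ r * ((2 : ℝ) ^ (-r)) ^ dyadicLevel x := by
  have h0 : (0 : ℝ) < 2 ^ dyadicLevel x := by positivity
  have h1 : (2 : ℝ) ^ dyadicLevel x / 2 ≤ max |x| 1 := by
    linarith [two_pow_dyadicLevel_le x]
  refine (Real.rpow_le_rpow_of_nonpos (by positivity) h1 (by linarith : -r ≤ 0)).trans_eq ?_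
  rw [Real.div_rpow h0.le zero_le_two, Real.rpow_pow_comm zero_le_two, Real.rpow_neg zero_le_two r,
    div_inv_eq_mul, mul_comm]

theorem dyadic_le_korobovWeight {r : ℝ} (hr : 0 ≤ r) (x : ℝ) :
    ((2 : ℝ) ^ (-r)) ^ dyadicLevel x ≤ korobovWeight r x := by
  rw [Real.rpow_pow_comm zero_le_two]
  exact Real.rpow_le_rpow_of_nonpos (lt_max_of_lt_right one_pos)
    (max_abs_one_le_two_pow_dyadicLevel x) (by linarith)

end Weight

section DyadicSums

theorem card_filter_sum_eq_le {e : ℕ} (F : Finset (Fin (e + 1) → ℕ)) (S : ℕ) :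
    (F.filter fun s => ∑ i, s i = S).card ≤ (S + 1) ^ e := by
  calc (F.filter fun s => ∑ i, s i = S).card
      ≤ (Fintype.piFinset fun _ : Fin e => Finset.range (S + 1)).card := by
        refine Finset.card_le_card_of_injOn (fun s i => s i.succ) (fun s hs => ?_)
          fun s hs t ht hst => ?_
        · have hs' : ∑ i, s i = S := (Finset.mem_filter.1 hs).2
          refine Fintype.mem_piFinset.2 fun i => Finset.mem_range.2 (Nat.lt_succ_of_le ?_)
          rw [← hs']
          exact Finset.single_le_sum (f := s) (fun _ _ => Nat.zero_le _) (Finset.mem_univ i.succ)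
        · have hs' : ∑ i, s i = S := (Finset.mem_filter.1 hs).2
          have ht' : ∑ i, t i = S := (Finset.mem_filter.1 ht).2
          rw [Fin.sum_univ_succ] at hs' ht'
          have hst' : ∀ i : Fin e, s i.succ = t i.succ := fun i => congrFun hst i
          simp only [hst'] at hs'
          funext i
          refine Fin.cases (by omega) hst' i
    _ = (S + 1) ^ e := by simp

theorem exists_sum_pow_sum_le (e a : ℕ) {ρ : ℝ} (h0 : 0 < ρ) (h1 : ρ < 1) :
    ∃ C : ℝ, 0 ≤ C ∧ ∀ (S₀ : ℕ) (F : Finset (Fin (e + 1) → ℕ)),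
      (∀ s ∈ F, S₀ ≤ (∑ i, s i) + a) →
      ∑ s ∈ F, ρ ^ (∑ i, s i) ≤ C * (ρ ^ S₀ * ((S₀ : ℝ) + 1) ^ e) := by
  have hsum : Summable fun t : ℕ => ((t : ℝ) + 1) ^ e * ρ ^ t := by
    have hρ : ‖ρ‖ < 1 := by rwa [Real.norm_of_nonneg h0.le]
    have h := (summable_nat_add_iff (f := fun n : ℕ => (n : ℝ) ^ e * ρ ^ n) 1).2
      (summable_pow_mul_geometric_of_norm_lt_one e hρ)
    refine (h.mul_left ρ⁻¹).congr fun t => ?_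
    push_cast
    rw [pow_succ]
    field_simp
  have hρa : 0 < ρ ^ a := by positivity
  refine ⟨(ρ ^ a)⁻¹ * ∑' t : ℕ, ((t : ℝ) + 1) ^ e * ρ ^ t,
    mul_nonneg (by positivity) (tsum_nonneg fun t => by positivity), fun S₀ F hF => ?_⟩
  set lev : (Fin (e + 1) → ℕ) → ℕ := fun s => (∑ i, s i) + a - S₀ with hlev
  rw [← Finset.sum_fiberwise_of_maps_to (t := F.image lev) (g := lev)
    (fun s hs => Finset.mem_image_of_mem _ hs)]
  have hfib : ∀ t ∈ F.image lev, ∑ s ∈ F with lev s = t, ρ ^ (∑ i, s i) ≤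
      (ρ ^ a)⁻¹ * (ρ ^ S₀ * ((S₀ : ℝ) + 1) ^ e) * (((t : ℝ) + 1) ^ e * ρ ^ t) := by
    intro t _
    have hpt : ∀ s ∈ F.filter (fun s => lev s = t),
        ρ ^ (∑ i, s i) ≤ (ρ ^ a)⁻¹ * (ρ ^ S₀ * ρ ^ t) := by
      intro s hs
      obtain ⟨hs, hst⟩ := Finset.mem_filter.1 hs
      have := hF s hs
      have he : (∑ i, s i) + a = S₀ + t := by simp only [hlev] at hst; omega
      rw [← pow_add, ← he, pow_add, mul_comm (ρ ^ _), inv_mul_cancel_left₀ hρa.ne']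
    have hcard : ((F.filter fun s => lev s = t).card : ℝ) ≤ (((S₀ : ℝ) + 1) * ((t : ℝ) + 1)) ^ e := by
      rcases (F.filter fun s => lev s = t).eq_empty_or_nonempty with h | ⟨s₀, hs₀⟩
      · rw [h]
        simp only [Finset.card_empty, Nat.cast_zero]
        positivity
      · obtain ⟨hs₀F, hs₀t⟩ := Finset.mem_filter.1 hs₀
        have h2 := hF _ hs₀F
        have hsub : (F.filter fun s => lev s = t) ⊆
            F.filter fun s => ∑ i, s i = ∑ i, s₀ i := by
          intro s hs
          obtain ⟨hs, hst⟩ := Finset.mem_filter.1 hs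
          refine Finset.mem_filter.2 ⟨hs, ?_⟩
          have := hF s hs
          simp only [hlev] at hst hs₀t
          omega
        have h3 := (Finset.card_le_card hsub).trans (card_filter_sum_eq_le F _)
        have h4 : (∑ i, s₀ i) + 1 ≤ (S₀ + 1) * (t + 1) := by
          simp only [hlev] at hs₀t
          have : (∑ i, s₀ i) + a = S₀ + t := by omega
          nlinarith
        have h5 := h3.trans (Nat.pow_le_pow_left h4 e)
        exact_mod_cast h5
    refine (Finset.sum_le_card_nsmul _ _ _ hpt).trans ?_
    rw [nsmul_eq_mul]
    refine (mul_le_mul_of_nonneg_right hcard (by positivity)).trans_eq ?_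
    rw [mul_pow]
    ring
  refine (Finset.sum_le_sum hfib).trans ?_
  rw [← Finset.mul_sum]
  have := hsum.sum_le_tsum (F.image lev) (fun t _ => by positivity)
  refine (mul_le_mul_of_nonneg_left this (by positivity)).trans_eq ?_
  ring

theorem card_box_le {e : ℕ} {v : (Fin (e + 1) → ℤ) → Fin (e + 1) → ℝ} {N : ℝ} (hN : 0 < N)
    (hv : ∀ w w' i, v (w - w') i = v w i - v w' i) (hprod : ∀ w, w ≠ 0 → N ≤ ∏ i, |v w i|)
    (s : Fin (e + 1) → ℕ) (W : Finset (Fin (e + 1) → ℤ)) (h0 : ∀ w ∈ W, w ≠ 0)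
    (hW : ∀ w ∈ W, ∀ i, |v w i| < 2 ^ s i) :
    (W.card : ℝ) ≤ 2 ^ (e + 3) / N * 2 ^ (∑ i, s i) := by
  rcases W.eq_empty_or_nonempty with rfl | ⟨w₀, hw₀⟩
  · simp only [Finset.card_empty, Nat.cast_zero]
    positivity
  have hNs : N ≤ 2 ^ (∑ i, s i) := by
    rw [← Finset.prod_pow_eq_pow_sum]
    exact (hprod _ (h0 _ hw₀)).trans
      (Finset.prod_le_prod (fun _ _ => abs_nonneg _) fun i _ => (hW _ hw₀ i).le)
  set P : ℝ := ∏ i : Fin e, (2 : ℝ) ^ (s i.succ + 1) with hP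
  have hPpos : 0 < P := Finset.prod_pos fun _ _ => by positivity
  set δ : ℝ := N / P with hδ
  have hδpos : 0 < δ := div_pos hN hPpos
  set X : ℤ := ⌈2 ^ s 0 / δ⌉ with hX
  have hX0 : 0 ≤ X := Int.ceil_nonneg (by positivity)
  have hcard : W.card ≤ (Finset.Icc (-X) X).card := by
    refine Finset.card_le_card_of_injOn (fun w => ⌊v w 0 / δ⌋) (fun w hw => ?_)
      fun w hw w' hw' hww => ?_
    · have h := abs_lt.1 (hW w hw 0)
      have h1 : v w 0 / δ ≤ 2 ^ s 0 / δ := by gcongr; exact h.2.le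
      have h2 : -(2 ^ s 0 / δ) ≤ v w 0 / δ := by rw [← neg_div]; gcongr; exact h.1.le
      refine Finset.mem_coe.2 (Finset.mem_Icc.2 ⟨Int.le_floor.2 ?_, ?_⟩)
      · push_cast
        linarith [Int.le_ceil (2 ^ s 0 / δ)]
      · exact (Int.cast_le (R := ℝ)).1 ((Int.floor_le _).trans (h1.trans (Int.le_ceil _)))
    · by_contra hne
      have h1 := hprod (w - w') (sub_ne_zero.2 hne)
      rw [Fin.prod_univ_succ] at h1
      have h2 : |v (w - w') 0| < δ := by
        have := Int.abs_sub_lt_one_of_floor_eq_floor hww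
        rw [← sub_div, abs_div, abs_of_pos hδpos, div_lt_one hδpos] at this
        rwa [hv]
      have h3 : ∏ i : Fin e, |v (w - w') i.succ| ≤ P := by
        refine Finset.prod_le_prod (fun _ _ => abs_nonneg _) fun i _ => ?_
        rw [hv, pow_succ]
        refine (abs_sub _ _).trans ?_
        linarith [hW w hw i.succ, hW w' hw' i.succ]
      have h4 : |v (w - w') 0| * ∏ i : Fin e, |v (w - w') i.succ| < δ * P :=
        mul_lt_mul_of_lt_of_le_of_nonneg_of_pos h2 h3 (abs_nonneg _) hPpos
      rw [hδ, div_mul_cancel₀ _ hPpos.ne'] at h4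
      linarith
  rw [Int.card_Icc] at hcard
  have hcard' : (W.card : ℝ) ≤ 2 * X + 1 := by
    have : (W.card : ℤ) ≤ 2 * X + 1 := by omega
    exact_mod_cast this
  have hXle : (X : ℝ) < 2 ^ s 0 / δ + 1 := Int.ceil_lt_add_one _
  have hPe : P = 2 ^ e * ∏ i : Fin e, (2 : ℝ) ^ s i.succ := by
    simp [hP, pow_succ, Finset.prod_mul_distrib, mul_comm]
  have hdiv : 2 ^ s 0 / δ = 2 ^ e / N * 2 ^ (∑ i, s i) := by
    rw [hδ, Fin.sum_univ_succ, pow_add, ← Finset.prod_pow_eq_pow_sum, hPe]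
    field_simp
  have h1 : 1 ≤ 2 ^ (∑ i, s i) / N := (one_le_div hN).2 hNs
  have h2 : (1 : ℝ) ≤ 2 ^ e := one_le_pow₀ (by norm_num)
  have h3 : 1 ≤ 2 ^ e / N * 2 ^ (∑ i, s i) := by
    calc (1 : ℝ) ≤ 2 ^ e * (2 ^ (∑ i, s i) / N) := one_le_mul_of_one_le_of_one_le h2 h1
      _ = _ := by ring
  have h4 : (2 : ℝ) ^ (e + 3) / N * 2 ^ (∑ i, s i) = 8 * (2 ^ e / N * 2 ^ (∑ i, s i)) := by
    rw [pow_add]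
    ring
  rw [h4]
  linarith

/-- The Korobov weights summed over the nonzero points of a lattice whose nonzero points have
coordinate product at least `N`. -/
theorem exists_sum_korobovWeightPi_lattice_le (e a : ℕ) {r : ℝ} (hr : 1 < r) :
    ∃ C : ℝ, 0 ≤ C ∧ ∀ (S₀ : ℕ) (N : ℝ) (v : (Fin (e + 1) → ℤ) → Fin (e + 1) → ℝ),
      (2 : ℝ) ^ S₀ ≤ 2 ^ a * N → (∀ w w' i, v (w - w') i = v w i - v w' i) →
      (∀ w, w ≠ 0 → N ≤ ∏ i, |v w i|) → ∀ W : Finset (Fin (e + 1) → ℤ), (∀ w ∈ W, w ≠ 0) →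
      ∑ w ∈ W, korobovWeightPi r (v w) ≤
        C * (((2 : ℝ) ^ (-r)) ^ S₀ * ((S₀ : ℝ) + 1) ^ e) := by
  set q : ℝ := (2 : ℝ) ^ (-r) with hq
  have hq0 : 0 < q := by positivity
  have hq1 : 2 * q < 1 := by
    have : q < (2 : ℝ) ^ (-1 : ℝ) := Real.rpow_lt_rpow_of_exponent_lt (by norm_num) (by linarith)
    rw [Real.rpow_neg_one] at this
    linarith
  obtain ⟨C, hC0, hC⟩ := exists_sum_pow_sum_le e a (mul_pos two_pos hq0) hq1
  refine ⟨((2 : ℝ) ^ r) ^ (e + 1) * (2 ^ (e + 3) * 2 ^ a) * C, by positivity,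
    fun S₀ N v hSN hv hprod W hW => ?_⟩
  have hN : 0 < N := by
    by_contra h
    have h1 : (0 : ℝ) < 2 ^ S₀ := by positivity
    have h2 : (2 : ℝ) ^ a * N ≤ 0 := mul_nonpos_of_nonneg_of_nonpos (by positivity) (not_lt.1 h)
    linarith
  set lev : (Fin (e + 1) → ℤ) → Fin (e + 1) → ℕ := fun w i => dyadicLevel (v w i) with hlev
  have hK : ∀ w, korobovWeightPi r (v w) ≤ ((2 : ℝ) ^ r) ^ (e + 1) * q ^ (∑ i, lev w i) := by
    intro w
    refine (Finset.prod_le_prod (fun i _ => (korobovWeight_pos r _).le)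
      fun i _ => korobovWeight_le_dyadic (by linarith) (v w i)).trans_eq ?_
    rw [Finset.prod_mul_distrib, Finset.prod_pow_eq_pow_sum]
    simp [hlev, hq]
  rw [← Finset.sum_fiberwise_of_maps_to (t := W.image lev) (g := lev)
    (fun s hs => Finset.mem_image_of_mem _ hs)]
  have hfib : ∀ s ∈ W.image lev, ∑ w ∈ W with lev w = s, korobovWeightPi r (v w) ≤
      ((2 : ℝ) ^ r) ^ (e + 1) * (2 ^ (e + 3) / N) * (2 * q) ^ (∑ i, s i) := by
    intro s _
    have h1 : ∀ w ∈ W.filter (fun w => lev w = s),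
        korobovWeightPi r (v w) ≤ ((2 : ℝ) ^ r) ^ (e + 1) * q ^ (∑ i, s i) := by
      intro w hw
      rw [← (Finset.mem_filter.1 hw).2]
      exact hK w
    refine (Finset.sum_le_card_nsmul _ _ _ h1).trans ?_
    rw [nsmul_eq_mul]
    have h2 := card_box_le hN hv hprod s (W.filter fun w => lev w = s)
      (fun w hw => hW w (Finset.mem_filter.1 hw).1)
      (fun w hw i => by
        rw [← (Finset.mem_filter.1 hw).2]
        exact abs_lt_two_pow_dyadicLevel _)
    refine (mul_le_mul_of_nonneg_right h2 (by positivity)).trans_eq ?_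
    rw [mul_pow]
    ring
  refine (Finset.sum_le_sum hfib).trans ?_
  rw [← Finset.mul_sum]
  have hlow : ∀ s ∈ W.image lev, S₀ ≤ (∑ i, s i) + a := by
    intro s hs
    obtain ⟨w, hw, rfl⟩ := Finset.mem_image.1 hs
    have h1 : N ≤ 2 ^ (∑ i, lev w i) := by
      rw [← Finset.prod_pow_eq_pow_sum]
      exact (hprod _ (hW _ hw)).trans (Finset.prod_le_prod (fun _ _ => abs_nonneg _)
        fun i _ => (abs_lt_two_pow_dyadicLevel _).le)
    have h2 : (2 : ℝ) ^ S₀ ≤ 2 ^ ((∑ i, lev w i) + a) := by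
      rw [pow_add, mul_comm]
      exact hSN.trans (mul_le_mul_of_nonneg_left h1 (by positivity))
    exact (pow_le_pow_iff_right₀ (by norm_num)).1 h2
  have hNinv : 2 ^ S₀ / N ≤ 2 ^ a := (div_le_iff₀ hN).2 hSN
  refine (mul_le_mul_of_nonneg_left (hC S₀ _ hlow) (by positivity)).trans ?_
  calc ((2 : ℝ) ^ r) ^ (e + 1) * (2 ^ (e + 3) / N) * (C * ((2 * q) ^ S₀ * ((S₀ : ℝ) + 1) ^ e))
      = ((2 : ℝ) ^ r) ^ (e + 1) * 2 ^ (e + 3) * C * (q ^ S₀ * ((S₀ : ℝ) + 1) ^ e) *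
        (2 ^ S₀ / N) := by rw [mul_pow]; ring
    _ ≤ ((2 : ℝ) ^ r) ^ (e + 1) * 2 ^ (e + 3) * C * (q ^ S₀ * ((S₀ : ℝ) + 1) ^ e) * 2 ^ a :=
        mul_le_mul_of_nonneg_left hNinv (by positivity)
    _ = _ := by ring

end DyadicSums

section TorusMeasure

open MeasureTheory

theorem torusCube_eq_Icc (d : ℕ) :
    torusCube d = Set.Icc (fun _ => (0 : ℝ)) (fun _ => 2 * Real.pi) :=
  Set.pi_univ_Icc _ _

theorem isCompact_torusCube (d : ℕ) : IsCompact (torusCube d) := by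
  rw [torusCube_eq_Icc]
  exact isCompact_Icc

theorem volume_torusCube (d : ℕ) : volume (torusCube d) = ENNReal.ofReal ((2 * Real.pi) ^ d) := by
  rw [torusCube_eq_Icc, Real.volume_Icc_pi]
  simp [ENNReal.ofReal_pow Real.two_pi_pos.le]

theorem volume_torusCube_ne_zero (d : ℕ) : volume (torusCube d) ≠ 0 := by
  rw [volume_torusCube, Ne, ENNReal.ofReal_eq_zero, not_le]
  exact pow_pos Real.two_pi_pos d

instance isProbabilityMeasure_torusMeasure (d : ℕ) : IsProbabilityMeasure (torusMeasure d) :=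
  ProbabilityTheory.cond_isProbabilityMeasure_of_finite (volume_torusCube_ne_zero d)
    (isCompact_torusCube d).measure_lt_top.ne

theorem integral_torusMeasure {d : ℕ} {E : Type*} [NormedAddCommGroup E] [NormedSpace ℝ E]
    (f : (Fin d → ℝ) → E) :
    ∫ x, f x ∂torusMeasure d = ((2 * Real.pi) ^ d)⁻¹ • ∫ x in torusCube d, f x := by
  rw [torusMeasure, ProbabilityTheory.cond, integral_smul_measure, volume_torusCube,
    ENNReal.toReal_inv, ENNReal.toReal_ofReal (pow_nonneg Real.two_pi_pos.le d)]

theorem Continuous.integrable_torusMeasure {d : ℕ} {E : Type*} [NormedAddCommGroup E]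
    {f : (Fin d → ℝ) → E} (hf : Continuous f) : Integrable f (torusMeasure d) := by
  rw [torusMeasure, ProbabilityTheory.cond]
  refine Integrable.smul_measure ?_ (ENNReal.inv_ne_top.2 (volume_torusCube_ne_zero d))
  exact hf.continuousOn.integrableOn_compact (isCompact_torusCube d)

end TorusMeasure

section UnitTorus

open MeasureTheory
open scoped Pointwise

/-- The circle `ℝ / ℤ` with its normalized Haar measure. -/
noncomputable local instance unitAddCircleHaarMeasureSpace : MeasureSpace UnitAddCircle :=
  ⟨AddCircle.haarAddCircle⟩

local instance unitAddCircleHaar_isAddHaarMeasure :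
    Measure.IsAddHaarMeasure (volume : Measure UnitAddCircle) :=
  inferInstanceAs (Measure.IsAddHaarMeasure AddCircle.haarAddCircle)

local instance unitAddCircleHaar_isProbabilityMeasure :
    IsProbabilityMeasure (volume : Measure UnitAddCircle) :=
  inferInstanceAs (IsProbabilityMeasure AddCircle.haarAddCircle)

/-- The covering map `x ↦ x / 2π` of the unit torus. -/
noncomputable def toUnitTorus {d : ℕ} (x : Fin d → ℝ) : UnitAddTorus (Fin d) :=
  fun j => ((x j / (2 * Real.pi) : ℝ) : UnitAddCircle)

theorem integral_toUnitTorus {d : ℕ} {E : Type*} [NormedAddCommGroup E] [NormedSpace ℝ E]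
    (G : UnitAddTorus (Fin d) → E) :
    ∫ x, G (toUnitTorus x) ∂torusMeasure d = ∫ y, G y := by
  rw [UnitAddTorus.integral_preimage G (fun _ => 0), integral_torusMeasure]
  have h := Measure.setIntegral_comp_smul_of_pos (volume : Measure (Fin d → ℝ))
    (fun x => G (toUnitTorus x)) {x : Fin d → ℝ | ∀ i, x i ∈ Set.Ioc (0 : ℝ) (0 + 1)}
    Real.two_pi_pos
  have h1 : ∀ x : Fin d → ℝ, toUnitTorus ((2 * Real.pi) • x) =
      fun i => ((x i : ℝ) : UnitAddCircle) := by
    intro x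
    funext i
    simp only [toUnitTorus, Pi.smul_apply, smul_eq_mul]
    rw [mul_div_cancel_left₀ _ Real.two_pi_pos.ne']
  simp only [h1] at h
  rw [h, Module.finrank_fin_fun]
  congr 1
  have hset : (2 * Real.pi) • {x : Fin d → ℝ | ∀ i, x i ∈ Set.Ioc (0 : ℝ) (0 + 1)} =
      Set.univ.pi fun _ => Set.Ioc (0 : ℝ) (2 * Real.pi) := by
    ext x
    rw [Set.mem_smul_set_iff_inv_smul_mem₀ Real.two_pi_pos.ne']
    simp only [Set.mem_ofPred_eq, Set.mem_univ_pi, Pi.smul_apply, smul_eq_mul, Set.mem_Ioc, zero_add]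
    refine forall_congr' fun i => and_congr ?_ ?_
    · exact mul_pos_iff_of_pos_left (inv_pos.2 Real.two_pi_pos)
    · rw [inv_mul_le_iff₀ Real.two_pi_pos, mul_one]
  rw [hset]
  refine setIntegral_congr_set ?_
  rw [torusCube_eq_Icc]
  exact Measure.univ_pi_Ioc_ae_eq_Icc.symm

/-- `f` is `2π`-periodic in each variable. -/
def IsTorusPeriodic {d : ℕ} {E : Type*} (f : (Fin d → ℝ) → E) : Prop :=
  ∀ (x : Fin d → ℝ) (z : Fin d → ℤ), f (fun j => x j + z j * (2 * Real.pi)) = f x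

theorem isTorusPeriodic_of_update {d : ℕ} {E : Type*} {f : (Fin d → ℝ) → E}
    (hf : ∀ (x : Fin d → ℝ) (j : Fin d), f (Function.update x j (x j + 2 * Real.pi)) = f x) :
    IsTorusPeriodic f := by
  have hone : ∀ (j : Fin d) (n : ℤ) (x : Fin d → ℝ),
      f (Function.update x j (x j + n * (2 * Real.pi))) = f x := by
    intro j n
    induction n using Int.induction_on with
    | zero => intro x; simp
    | succ n ih =>
      intro x
      rw [← ih x, ← hf (Function.update x j (x j + ((n : ℤ) : ℝ) * (2 * Real.pi))) j]
      simp only [Function.update_self, Function.update_idem]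
      congr 2
      push_cast
      ring
    | pred n ih =>
      intro x
      rw [← ih x, ← hf (Function.update x j (x j + ((-(n : ℤ) - 1 : ℤ) : ℝ) * _)) j]
      simp only [Function.update_self, Function.update_idem]
      congr 2
      push_cast
      ring
  intro x z
  have hs : ∀ s : Finset (Fin d),
      f (fun j => if j ∈ s then x j + z j * (2 * Real.pi) else x j) = f x := by
    intro s
    induction s using Finset.induction_on with
    | empty => simp
    | insert a s ha ih =>
      rw [← ih, ← hone a (z a) fun j => if j ∈ s then x j + z j * (2 * Real.pi) else x j]
      congr 1
      funext j
      rcases eq_or_ne j a with rfl | hj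
      · simp [ha]
      · simp [hj]
  simpa using hs Finset.univ

theorem exists_lift_toUnitTorus {d : ℕ} {f : (Fin d → ℝ) → ℂ} (hf : Continuous f)
    (hper : IsTorusPeriodic f) :
    ∃ F : C(UnitAddTorus (Fin d), ℂ), ∀ x, F (toUnitTorus x) = f x := by
  let p : C(Fin d → ℝ, UnitAddTorus (Fin d)) :=
    ⟨Pi.map fun (_ : Fin d) (x : ℝ) => (x : UnitAddCircle),
      (IsOpenQuotientMap.piMap fun _ => QuotientAddGroup.isOpenQuotientMap_mk).continuous⟩
  have hq : Topology.IsQuotientMap p :=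
    (IsOpenQuotientMap.piMap fun _ => QuotientAddGroup.isOpenQuotientMap_mk).isQuotientMap
  let g : C(Fin d → ℝ, ℂ) := ⟨fun u => f fun j => u j * (2 * Real.pi), by fun_prop⟩
  have hg : Function.FactorsThrough g p := by
    intro u v huv
    have h1 : ∀ j, ∃ n : ℤ, u j = v j + n := by
      intro j
      have h2 : ((u j : ℝ) : UnitAddCircle) = v j := congrFun huv j
      rw [← sub_eq_zero, ← AddCircle.coe_sub, AddCircle.coe_eq_zero_iff] at h2
      obtain ⟨n, hn⟩ := h2
      exact ⟨n, by rw [zsmul_one] at hn; linarith⟩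
    choose z hz using h1
    change f _ = f _
    rw [← hper (fun j => v j * (2 * Real.pi)) z]
    congr 1
    funext j
    rw [hz j]
    ring
  refine ⟨⟨_, (hq.lift g hg).continuous⟩, fun x => ?_⟩
  have h := hq.lift_comp g hg
  have h2 := DFunLike.congr_fun h fun j => x j / (2 * Real.pi)
  refine h2.trans ?_
  change f _ = f _
  congr 1
  funext j
  exact div_mul_cancel₀ _ Real.two_pi_pos.ne'

end UnitTorus

section Characters

open MeasureTheory

/-- The character `x ↦ exp(i (k, x))`. -/
noncomputable def torusChar {d : ℕ} (k : Fin d → ℤ) (x : Fin d → ℝ) : ℂ :=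
  Complex.exp (Complex.I * ((∑ j, (k j : ℝ) * x j : ℝ) : ℂ))

theorem continuous_torusChar {d : ℕ} (k : Fin d → ℤ) : Continuous (torusChar k) := by
  unfold torusChar
  fun_prop

theorem norm_torusChar {d : ℕ} (k : Fin d → ℤ) (x : Fin d → ℝ) : ‖torusChar k x‖ = 1 := by
  rw [torusChar, mul_comm, Complex.norm_exp_ofReal_mul_I]

theorem torusChar_add {d : ℕ} (k l : Fin d → ℤ) (x : Fin d → ℝ) :
    torusChar (k + l) x = torusChar k x * torusChar l x := by
  simp only [torusChar, ← Complex.exp_add, ← mul_add, ← Complex.ofReal_add,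
    ← Finset.sum_add_distrib, Pi.add_apply, Int.cast_add, add_mul]

theorem torusChar_zero {d : ℕ} (x : Fin d → ℝ) : torusChar 0 x = 1 := by
  simp [torusChar]

theorem torusChar_neg {d : ℕ} (k : Fin d → ℤ) (x : Fin d → ℝ) :
    torusChar (-k) x = (starRingEnd ℂ) (torusChar k x) := by
  simp only [torusChar, ← Complex.exp_conj, map_mul, Complex.conj_I, Complex.conj_ofReal]
  simp

theorem torusChar_sub {d : ℕ} (k l : Fin d → ℤ) (x : Fin d → ℝ) :
    torusChar (k - l) x = torusChar k x * (starRingEnd ℂ) (torusChar l x) := by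
  rw [sub_eq_add_neg, torusChar_add, torusChar_neg]

theorem torusFourierCoeff_eq {d : ℕ} (f : (Fin d → ℝ) → ℂ) (k : Fin d → ℤ) :
    torusFourierCoeff f k = ∫ x, f x * torusChar (-k) x ∂torusMeasure d := by
  simp [torusFourierCoeff, torusChar]

theorem torusFourierCoeff_torusChar_mul {d : ℕ} (l : Fin d → ℤ) (g : (Fin d → ℝ) → ℂ)
    (k : Fin d → ℤ) :
    torusFourierCoeff (fun x => torusChar l x * g x) k = torusFourierCoeff g (k - l) := by
  rw [torusFourierCoeff_eq, torusFourierCoeff_eq, neg_sub, sub_eq_add_neg]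
  simp only [torusChar_add]
  congr 1
  funext x
  ring

theorem norm_torusFourierCoeff_le {d : ℕ} (f : (Fin d → ℝ) → ℂ) (k : Fin d → ℤ) :
    ‖torusFourierCoeff f k‖ ≤ ∫ x, ‖f x‖ ∂torusMeasure d := by
  rw [torusFourierCoeff_eq]
  refine (norm_integral_le_integral_norm _).trans_eq ?_
  simp [norm_torusChar]

theorem torusFourierCoeff_zero {d : ℕ} (f : (Fin d → ℝ) → ℂ) :
    torusFourierCoeff f 0 = ∫ x, f x ∂torusMeasure d := by
  simp [torusFourierCoeff_eq, torusChar_zero]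

theorem torusFourierCoeff_conj {d : ℕ} (f : (Fin d → ℝ) → ℂ) (k : Fin d → ℤ) :
    torusFourierCoeff (fun x => (starRingEnd ℂ) (f x)) k =
      (starRingEnd ℂ) (torusFourierCoeff f (-k)) := by
  rw [torusFourierCoeff_eq, torusFourierCoeff_eq, ← integral_conj]
  simp only [map_mul, ← torusChar_neg, neg_neg]

theorem torusFourierCoeff_add {d : ℕ} {f g : (Fin d → ℝ) → ℂ} (hf : Continuous f)
    (hg : Continuous g) (k : Fin d → ℤ) :
    torusFourierCoeff (fun x => f x + g x) k = torusFourierCoeff f k + torusFourierCoeff g k := by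
  simp only [torusFourierCoeff_eq, add_mul]
  exact integral_add (hf.mul (continuous_torusChar _)).integrable_torusMeasure
    (hg.mul (continuous_torusChar _)).integrable_torusMeasure

theorem torusFourierCoeff_sum {d : ℕ} {ι : Type*} (s : Finset ι) {f : ι → (Fin d → ℝ) → ℂ}
    (hf : ∀ i ∈ s, Continuous (f i)) (k : Fin d → ℤ) :
    torusFourierCoeff (fun x => ∑ i ∈ s, f i x) k = ∑ i ∈ s, torusFourierCoeff (f i) k := by
  simp only [torusFourierCoeff_eq, Finset.sum_mul]
  exact integral_finsetSum _ fun i hi =>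
    ((hf i hi).mul (continuous_torusChar _)).integrable_torusMeasure

theorem torusFourierCoeff_const_mul {d : ℕ} (c : ℂ) (f : (Fin d → ℝ) → ℂ) (k : Fin d → ℤ) :
    torusFourierCoeff (fun x => c * f x) k = c * torusFourierCoeff f k := by
  simp only [torusFourierCoeff_eq, mul_assoc]
  exact integral_const_mul _ _

attribute [local instance] unitAddCircleHaarMeasureSpace unitAddCircleHaar_isAddHaarMeasure
  unitAddCircleHaar_isProbabilityMeasure

theorem mFourier_toUnitTorus {d : ℕ} (k : Fin d → ℤ) (x : Fin d → ℝ) :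
    UnitAddTorus.mFourier k (toUnitTorus x) = torusChar k x := by
  have hpi : (Real.pi : ℂ) ≠ 0 := by exact_mod_cast Real.pi_ne_zero
  simp only [UnitAddTorus.mFourier, toUnitTorus, ContinuousMap.coe_mk, fourier_coe_apply, torusChar,
    ← Complex.exp_sum, Complex.ofReal_sum, Finset.mul_sum]
  congr 1
  refine Finset.sum_congr rfl fun j _ => ?_
  push_cast
  field_simp

theorem isTorusPeriodic_torusChar {d : ℕ} (k : Fin d → ℤ) : IsTorusPeriodic (torusChar k) := by
  intro x z
  rw [← mFourier_toUnitTorus, ← mFourier_toUnitTorus]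
  congr 1
  funext j
  simp only [toUnitTorus]
  rw [add_div, mul_div_cancel_right₀ _ Real.two_pi_pos.ne', AddCircle.coe_add,
    (AddCircle.coe_eq_zero_iff (p := (1 : ℝ)) (x := (z j : ℝ))).2 ⟨z j, by simp⟩, add_zero]

theorem mFourierCoeff_eq_torusFourierCoeff {d : ℕ} {f : (Fin d → ℝ) → ℂ}
    {F : C(UnitAddTorus (Fin d), ℂ)} (hF : ∀ x, F (toUnitTorus x) = f x) (k : Fin d → ℤ) :
    UnitAddTorus.mFourierCoeff F k = torusFourierCoeff f k := by
  rw [UnitAddTorus.mFourierCoeff, ← integral_toUnitTorus, torusFourierCoeff_eq]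
  simp only [mFourier_toUnitTorus, hF, smul_eq_mul, mul_comm]

theorem hasSum_torusFourierCoeff {d : ℕ} {f : (Fin d → ℝ) → ℂ} (hf : Continuous f)
    (hper : IsTorusPeriodic f) (hs : Summable (torusFourierCoeff f)) (x : Fin d → ℝ) :
    HasSum (fun k => torusFourierCoeff f k * torusChar k x) (f x) := by
  obtain ⟨F, hF⟩ := exists_lift_toUnitTorus hf hper
  have hc : UnitAddTorus.mFourierCoeff F = torusFourierCoeff f :=
    funext (mFourierCoeff_eq_torusFourierCoeff hF)
  have h := UnitAddTorus.hasSum_mFourier_series_apply_of_summable (hc ▸ hs) (toUnitTorus x)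
  rw [hc, hF] at h
  simpa only [mFourier_toUnitTorus, smul_eq_mul] using h

theorem integral_torusChar {d : ℕ} (k : Fin d → ℤ) :
    ∫ x, torusChar k x ∂torusMeasure d = if k = 0 then 1 else 0 := by
  have h := (orthonormal_iff_ite.1 (UnitAddTorus.orthonormal_mFourier (d := Fin d))) 0 k
  simp only [ContinuousMap.inner_toLp] at h
  rw [← integral_toUnitTorus] at h
  simp only [mFourier_toUnitTorus, torusChar_zero, map_one, mul_one] at h
  rw [h]
  simp [eq_comm]

theorem hasSum_torusFourierCoeff_mul {d : ℕ} {f g : (Fin d → ℝ) → ℂ} (hf : Continuous f)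
    (hper : IsTorusPeriodic f) (hs : Summable (torusFourierCoeff f)) (hg : Continuous g)
    (k : Fin d → ℤ) :
    HasSum (fun l => torusFourierCoeff f l * torusFourierCoeff g (k - l))
      (torusFourierCoeff (fun x => f x * g x) k) := by
  set G : (Fin d → ℤ) → (Fin d → ℝ) → ℂ := fun l x =>
    torusFourierCoeff f l * (torusChar l x * g x * torusChar (-k) x) with hG
  have hGc : ∀ l, Continuous (G l) := fun l =>
    continuous_const.mul (((continuous_torusChar l).mul hg).mul (continuous_torusChar _))
  have hGn : ∀ l, ∫ x, ‖G l x‖ ∂torusMeasure d =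
      ‖torusFourierCoeff f l‖ * ∫ x, ‖g x‖ ∂torusMeasure d := by
    intro l
    simp only [hG, norm_mul, norm_torusChar, one_mul, mul_one]
    exact integral_const_mul _ _
  have h := hasSum_integral_of_summable_integral_norm (μ := torusMeasure d)
    (fun l => (hGc l).integrable_torusMeasure) (by
      simp only [hGn]
      exact hs.norm.mul_right _)
  have h1 : ∀ l, ∫ x, G l x ∂torusMeasure d =
      torusFourierCoeff f l * torusFourierCoeff g (k - l) := by
    intro l
    rw [← torusFourierCoeff_torusChar_mul, torusFourierCoeff_eq (fun x => torusChar l x * g x)]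
    exact integral_const_mul (torusFourierCoeff f l) fun x => torusChar l x * g x * torusChar (-k) x
  have h2 : ∫ x, ∑' l, G l x ∂torusMeasure d = torusFourierCoeff (fun x => f x * g x) k := by
    rw [torusFourierCoeff_eq]
    congr 1
    funext x
    have hx := ((hasSum_torusFourierCoeff hf hper hs x).mul_right (g x * torusChar (-k) x)).tsum_eq
    rw [mul_assoc, ← hx]
    refine tsum_congr fun l => ?_
    simp only [hG]
    ring
  simpa only [h1, h2] using h

end Characters

section KorobovBound

/-- Continuous periodic functions whose Fourier coefficients are bounded by a multiple of the
Korobov weight. -/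
structure HasKorobovBound {d : ℕ} (r C : ℝ) (f : (Fin d → ℝ) → ℂ) : Prop where
  continuous : Continuous f
  periodic : IsTorusPeriodic f
  bound : ∀ k : Fin d → ℤ,
    ‖torusFourierCoeff f k‖ ≤ C * korobovWeightPi r fun j => (k j : ℝ)

theorem HasKorobovBound.summable {d : ℕ} {r C : ℝ} (hr : 1 < r) {f : (Fin d → ℝ) → ℂ}
    (hf : HasKorobovBound r C f) : Summable (torusFourierCoeff f) :=
  Summable.of_norm_bounded ((summable_korobovWeightPi_int d hr).mul_left C) hf.bound

theorem HasKorobovBound.conj {d : ℕ} {r C : ℝ} {f : (Fin d → ℝ) → ℂ}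
    (hf : HasKorobovBound r C f) : HasKorobovBound r C fun x => (starRingEnd ℂ) (f x) where
  continuous := Complex.continuous_conj.comp hf.continuous
  periodic x z := congrArg _ (hf.periodic x z)
  bound k := by
    rw [torusFourierCoeff_conj, RCLike.norm_conj]
    refine (hf.bound (-k)).trans_eq ?_
    simp [korobovWeightPi, korobovWeight_neg]

theorem exists_hasKorobovBound_mul (d : ℕ) {r : ℝ} (hr : 1 < r) :
    ∃ D : ℝ, 0 ≤ D ∧ ∀ (C C' : ℝ) (f g : (Fin d → ℝ) → ℂ), 0 ≤ C → 0 ≤ C' →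
      HasKorobovBound r C f → HasKorobovBound r C' g →
      HasKorobovBound r (D * C * C') fun x => f x * g x := by
  obtain ⟨D, hD, hle⟩ := exists_tsum_korobovWeightPi_conv_le d hr
  refine ⟨D.toReal, ENNReal.toReal_nonneg, fun C C' f g hC hC' hf hg =>
    ⟨hf.continuous.mul hg.continuous, fun x z => by rw [hf.periodic x z, hg.periodic x z],
      fun k => ?_⟩⟩
  have hw := fun y : Fin d → ℝ => (korobovWeightPi_pos r y).le
  have hk := hle fun j => (k j : ℝ)
  rw [← (hasSum_torusFourierCoeff_mul hf.continuous hf.periodic (hf.summable hr)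
    hg.continuous k).tsum_eq]
  have h1 : ‖∑' l, torusFourierCoeff f l * torusFourierCoeff g (k - l)‖ₑ ≤
      ENNReal.ofReal (D.toReal * C * C' * korobovWeightPi r fun j => (k j : ℝ)) := by
    calc ‖∑' l, torusFourierCoeff f l * torusFourierCoeff g (k - l)‖ₑ
        ≤ ∑' l, ‖torusFourierCoeff f l * torusFourierCoeff g (k - l)‖ₑ := enorm_tsum_le_tsum_enorm
      _ ≤ ∑' l : Fin d → ℤ, ENNReal.ofReal (C * C') *
            (ENNReal.ofReal (korobovWeightPi r fun j => (l j : ℝ)) *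
              ENNReal.ofReal (korobovWeightPi r fun j => (k j : ℝ) - l j)) := by
          refine ENNReal.tsum_le_tsum fun l => ?_
          rw [← ENNReal.ofReal_mul (hw _), ← ENNReal.ofReal_mul (by positivity), ← ofReal_norm,
            norm_mul]
          refine ENNReal.ofReal_le_ofReal ?_
          have h2 := hg.bound (k - l)
          simp only [Pi.sub_apply, Int.cast_sub] at h2
          calc _ ≤ _ := mul_le_mul (hf.bound l) h2 (norm_nonneg _) (mul_nonneg hC (hw _))
            _ = _ := by ring
      _ ≤ ENNReal.ofReal (C * C') *
            (D * ENNReal.ofReal (korobovWeightPi r fun j => (k j : ℝ))) := by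
          rw [ENNReal.tsum_mul_left]
          gcongr
      _ = _ := by
          nth_rewrite 1 [← ENNReal.ofReal_toReal hD]
          rw [← ENNReal.ofReal_mul ENNReal.toReal_nonneg, ← ENNReal.ofReal_mul (by positivity)]
          congr 1
          ring
  rw [← ofReal_norm] at h1
  exact (ENNReal.ofReal_le_ofReal_iff (mul_nonneg (by positivity) (hw _))).1 h1

theorem exists_hasKorobovBound_norm_pow (d : ℕ) {r : ℝ} (hr : 1 < r) {n : ℕ} (hn : 1 ≤ n) :
    ∃ M : ℝ, 0 ≤ M ∧ ∀ f : (Fin d → ℝ) → ℂ, HasKorobovBound r 1 f →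
      HasKorobovBound r M fun x => ((‖f x‖ ^ (2 * n) : ℝ) : ℂ) := by
  obtain ⟨D, hD, hmul⟩ := exists_hasKorobovBound_mul d hr
  induction n, hn using Nat.le_induction with
  | base =>
    refine ⟨D * 1 * 1, by positivity, fun f hf => ?_⟩
    have h := hmul 1 1 f _ zero_le_one zero_le_one hf hf.conj
    simpa only [Complex.mul_conj, Complex.normSq_eq_norm_sq, mul_one] using h
  | succ n _ ih =>
    obtain ⟨M, hM, hb⟩ := ih
    refine ⟨D * M * (D * 1 * 1), by positivity, fun f hf => ?_⟩
    have h := hmul M _ _ _ hM (by positivity) (hb f hf)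
      (hmul 1 1 f _ zero_le_one zero_le_one hf hf.conj)
    simp only [Complex.mul_conj, Complex.normSq_eq_norm_sq, ← Complex.ofReal_mul, ← pow_add] at h
    exact h

theorem hasKorobovBound_of_mem_korobovClass {d : ℕ} {r : ℝ} {f : (Fin d → ℝ) → ℂ}
    (hf : f ∈ korobovClass d r) : HasKorobovBound r 1 f where
  continuous := hf.1
  periodic := isTorusPeriodic_of_update hf.2.1
  bound k := by
    rw [one_mul]
    exact hf.2.2 k

end KorobovBound

section Window

open MeasureTheory

/-- A smooth compactly supported function whose `2π`-translates form a partition of unity. -/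
noncomputable def torusWindow (x : ℝ) : ℝ :=
  Real.smoothTransition (x / (2 * Real.pi)) - Real.smoothTransition (x / (2 * Real.pi) - 1)

theorem contDiff_torusWindow {n : ℕ∞} : ContDiff ℝ n torusWindow :=
  (Real.smoothTransition.contDiff.comp (contDiff_id.div_const _)).sub
    (Real.smoothTransition.contDiff.comp ((contDiff_id.div_const _).sub contDiff_const))

theorem continuous_torusWindow : Continuous torusWindow :=
  (contDiff_torusWindow (n := 0)).continuous

theorem torusWindow_of_nonpos {x : ℝ} (hx : x ≤ 0) : torusWindow x = 0 := by
  have h : x / (2 * Real.pi) ≤ 0 := div_nonpos_of_nonpos_of_nonneg hx Real.two_pi_pos.le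
  rw [torusWindow, Real.smoothTransition.zero_of_nonpos h,
    Real.smoothTransition.zero_of_nonpos (by linarith), sub_zero]

theorem torusWindow_of_four_pi_le {x : ℝ} (hx : 4 * Real.pi ≤ x) : torusWindow x = 0 := by
  have h : 2 ≤ x / (2 * Real.pi) := by
    rw [le_div_iff₀ Real.two_pi_pos]
    linarith
  rw [torusWindow, Real.smoothTransition.one_of_one_le (by linarith),
    Real.smoothTransition.one_of_one_le (by linarith), sub_self]

theorem torusWindow_add_two_pi {x : ℝ} (h0 : 0 ≤ x) (h1 : x ≤ 2 * Real.pi) :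
    torusWindow x + torusWindow (x + 2 * Real.pi) = 1 := by
  have h2 : 0 ≤ x / (2 * Real.pi) := div_nonneg h0 Real.two_pi_pos.le
  have h3 : x / (2 * Real.pi) ≤ 1 := (div_le_one Real.two_pi_pos).2 h1
  rw [torusWindow, torusWindow, add_div, div_self Real.two_pi_pos.ne', add_sub_cancel_right,
    Real.smoothTransition.zero_of_nonpos (by linarith : x / (2 * Real.pi) - 1 ≤ 0),
    Real.smoothTransition.one_of_one_le (by linarith : 1 ≤ x / (2 * Real.pi) + 1)]
  ring

theorem abs_le_of_torusWindow_ne_zero {x : ℝ} (hx : torusWindow x ≠ 0) : |x| ≤ 4 * Real.pi := by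
  have h1 : 0 < x := not_le.1 fun h => hx (torusWindow_of_nonpos h)
  have h2 : x < 4 * Real.pi := not_le.1 fun h => hx (torusWindow_of_four_pi_le h)
  rw [abs_of_pos h1]
  exact h2.le

theorem hasCompactSupport_torusWindow : HasCompactSupport torusWindow :=
  HasCompactSupport.of_support_subset_isCompact (isCompact_closedBall (0 : ℝ) (4 * Real.pi))
    fun _ hx => by simpa using abs_le_of_torusWindow_ne_zero hx

/-- The normalized Fourier transform of `torusWindow`. -/
noncomputable def torusWindowFourier (y : ℝ) : ℂ :=
  (2 * Real.pi : ℂ)⁻¹ * ∫ x : ℝ, (torusWindow x : ℂ) * Complex.exp (-(Complex.I * ((y * x : ℝ) : ℂ)))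

theorem torusWindowFourier_int (k : ℤ) : torusWindowFourier k = if k = 0 then 1 else 0 := by
  set g : ℝ → ℂ := fun x => Complex.exp (-(Complex.I * (((k : ℝ) * x : ℝ) : ℂ))) with hg
  have hgc : Continuous g := by fun_prop
  have hwc : Continuous fun x => (torusWindow x : ℂ) * g x :=
    (Complex.continuous_ofReal.comp continuous_torusWindow).mul hgc
  have hws : Continuous fun x => (torusWindow (x + 2 * Real.pi) : ℂ) * g (x + 2 * Real.pi) :=
    hwc.comp (continuous_id.add continuous_const)
  have hgper : ∀ x, g (x + 2 * Real.pi) = g x := by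
    intro x
    have h : -(Complex.I * (((k : ℝ) * (x + 2 * Real.pi) : ℝ) : ℂ)) =
        -(Complex.I * (((k : ℝ) * x : ℝ) : ℂ)) + ((-k : ℤ) : ℂ) * (2 * Real.pi * Complex.I) := by
      push_cast
      ring
    simp only [hg]
    rw [h, Complex.exp_add, Complex.exp_int_mul_two_pi_mul_I, mul_one]
  have h1 : ∫ x : ℝ, (torusWindow x : ℂ) * g x = ∫ x in (0 : ℝ)..(2 * Real.pi), g x := by
    have hsub : (Function.support fun x => (torusWindow x : ℂ) * g x) ⊆
        Set.Ioc 0 (2 * Real.pi + 2 * Real.pi) := by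
      intro x hx
      have hx' : torusWindow x ≠ 0 := by
        have := left_ne_zero_of_mul hx
        exact_mod_cast this
      exact ⟨not_le.1 fun h => hx' (torusWindow_of_nonpos h),
        (not_le.1 fun h => hx' (torusWindow_of_four_pi_le (by linarith))).le⟩
    rw [← intervalIntegral.integral_eq_integral_of_support_subset hsub,
      ← intervalIntegral.integral_add_adjacent_intervals (b := 2 * Real.pi)
        (hwc.intervalIntegrable _ _) (hwc.intervalIntegrable _ _)]
    have h2 := intervalIntegral.integral_comp_add_right (a := 0) (b := 2 * Real.pi)
      (fun x => (torusWindow x : ℂ) * g x) (2 * Real.pi)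
    rw [zero_add] at h2
    rw [← h2, ← intervalIntegral.integral_add (hwc.intervalIntegrable _ _)
      (hws.intervalIntegrable _ _)]
    refine intervalIntegral.integral_congr fun x hx => ?_
    rw [Set.uIcc_of_le Real.two_pi_pos.le] at hx
    simp only [hgper]
    rw [← add_mul, ← Complex.ofReal_add, torusWindow_add_two_pi hx.1 hx.2]
    simp
  rw [torusWindowFourier, h1]
  have hpi : (2 * Real.pi : ℂ) ≠ 0 := by
    exact_mod_cast Real.two_pi_pos.ne'
  split_ifs with hk
  · subst hk
    simp only [hg, Int.cast_zero, zero_mul, Complex.ofReal_zero, mul_zero, neg_zero, Complex.exp_zero]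
    rw [intervalIntegral.integral_const, sub_zero, Complex.real_smul, mul_one]
    push_cast
    exact inv_mul_cancel₀ hpi
  · have hc : (-(Complex.I * (k : ℂ))) ≠ 0 :=
      neg_ne_zero.2 (mul_ne_zero Complex.I_ne_zero (by exact_mod_cast hk))
    have h3 : ∫ x in (0 : ℝ)..(2 * Real.pi), g x =
        ∫ x in (0 : ℝ)..(2 * Real.pi), Complex.exp (-(Complex.I * (k : ℂ)) * x) := by
      congr 1
      funext x
      simp only [hg]
      congr 1
      push_cast
      ring
    have h4 : -(Complex.I * (k : ℂ)) * ((2 * Real.pi : ℝ) : ℂ) =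
        ((-k : ℤ) : ℂ) * (2 * Real.pi * Complex.I) := by
      push_cast
      ring
    rw [h3, integral_exp_mul_complex hc, h4, Complex.exp_int_mul_two_pi_mul_I]
    simp

open FourierTransform in
theorem exists_norm_torusWindowFourier_le (r : ℝ) :
    ∃ C : ℝ, 0 ≤ C ∧ ∀ y, ‖torusWindowFourier y‖ ≤ C * korobovWeight r y := by
  have hcs : HasCompactSupport fun x => (torusWindow x : ℂ) :=
    hasCompactSupport_torusWindow.comp_left (g := fun x : ℝ => (x : ℂ)) Complex.ofReal_zero
  have hcd : ContDiff ℝ ((⊤ : ℕ∞) : WithTop ℕ∞) fun x => (torusWindow x : ℂ) :=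
    Complex.ofRealCLM.contDiff.comp contDiff_torusWindow
  set f : SchwartzMap ℝ ℂ := hcs.toSchwartzMap hcd with hf
  have hfour : ∀ y, torusWindowFourier y = (2 * Real.pi : ℂ)⁻¹ * (𝓕 f) (y / (2 * Real.pi)) := by
    intro y
    rw [torusWindowFourier, SchwartzMap.fourier_coe, Real.fourier_real_eq_integral_exp_smul]
    congr 2
    funext x
    rw [smul_eq_mul, mul_comm]
    congr 1
    congr 1
    push_cast
    have hpi : (Real.pi : ℂ) ≠ 0 := by exact_mod_cast Real.pi_ne_zero
    field_simp
  obtain ⟨C₀, hC₀, h0⟩ := (𝓕 f).decay 0 0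
  obtain ⟨C₁, hC₁, h1⟩ := (𝓕 f).decay ⌈r⌉₊ 0
  simp only [norm_iteratedFDeriv_zero, pow_zero, one_mul] at h0 h1
  have hn : ‖(2 * Real.pi : ℂ)⁻¹‖ ≤ 1 := by
    have : ‖(2 * Real.pi : ℂ)⁻¹‖ = (2 * Real.pi)⁻¹ := by
      rw [norm_inv, ← Complex.ofReal_ofNat, ← Complex.ofReal_mul, Complex.norm_real,
        Real.norm_of_nonneg Real.two_pi_pos.le]
    rw [this]
    exact inv_le_one_of_one_le₀ (by linarith [Real.pi_gt_three])
  refine ⟨max C₀ ((2 * Real.pi) ^ ⌈r⌉₊ * C₁), by positivity, fun y => ?_⟩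
  have hle : ‖torusWindowFourier y‖ ≤ ‖(𝓕 f) (y / (2 * Real.pi))‖ := by
    rw [hfour, norm_mul]
    exact mul_le_of_le_one_left (norm_nonneg _) hn
  refine hle.trans ?_
  rcases le_total |y| 1 with hy | hy
  · have : korobovWeight r y = 1 := by simp [korobovWeight, max_eq_right hy]
    rw [this, mul_one]
    exact (h0 _).trans (le_max_left _ _)
  · have hy0 : 0 < |y| := by linarith
    have h2 := h1 (y / (2 * Real.pi))
    rw [norm_div, Real.norm_eq_abs, Real.norm_of_nonneg Real.two_pi_pos.le, div_pow,
      div_mul_eq_mul_div, div_le_iff₀ (pow_pos Real.two_pi_pos _)] at h2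
    have h3 : korobovWeight r y = |y| ^ (-r) := by simp [korobovWeight, max_eq_left hy]
    have h4 : (|y| ^ ⌈r⌉₊)⁻¹ ≤ |y| ^ (-r) := by
      rw [← Real.rpow_natCast, ← Real.rpow_neg hy0.le]
      exact Real.rpow_le_rpow_of_exponent_le hy (neg_le_neg (Nat.le_ceil r))
    rw [h3]
    calc ‖(𝓕 f) (y / (2 * Real.pi))‖
        = (|y| ^ ⌈r⌉₊ * ‖(𝓕 f) (y / (2 * Real.pi))‖) * (|y| ^ ⌈r⌉₊)⁻¹ := by
          field_simp
      _ ≤ (C₁ * (2 * Real.pi) ^ ⌈r⌉₊) * |y| ^ (-r) :=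
          mul_le_mul h2 h4 (by positivity) (by positivity)
      _ ≤ _ := by
          refine mul_le_mul_of_nonneg_right ?_ (by positivity)
          rw [mul_comm]
          exact le_max_right _ _

/-- The tensor product window on `ℝ^d`. -/
noncomputable def torusWindowPi {d : ℕ} (x : Fin d → ℝ) : ℝ := ∏ j, torusWindow (x j)

theorem continuous_torusWindowPi {d : ℕ} : Continuous (torusWindowPi (d := d)) :=
  continuous_finsetProd _ fun j _ => continuous_torusWindow.comp (continuous_apply j)

theorem abs_le_of_torusWindowPi_ne_zero {d : ℕ} {x : Fin d → ℝ} (hx : torusWindowPi x ≠ 0)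
    (j : Fin d) : |x j| ≤ 4 * Real.pi :=
  abs_le_of_torusWindow_ne_zero (Finset.prod_ne_zero_iff.1 hx j (Finset.mem_univ j))

/-- The normalized Fourier transform of `torusWindowPi`. -/
noncomputable def torusWindowPiFourier {d : ℕ} (y : Fin d → ℝ) : ℂ :=
  ∏ j, torusWindowFourier (y j)

theorem torusWindowPiFourier_eq_integral {d : ℕ} (y : Fin d → ℝ) :
    torusWindowPiFourier y = ((2 * Real.pi : ℂ) ^ d)⁻¹ *
      ∫ x : Fin d → ℝ, (torusWindowPi x : ℂ) *
        Complex.exp (-(Complex.I * ((∑ j, y j * x j : ℝ) : ℂ))) := by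
  simp only [torusWindowPiFourier, torusWindowFourier, Finset.prod_mul_distrib]
  rw [← integral_fintype_prod_volume_eq_prod (fun (j : Fin d) (x : ℝ) =>
    (torusWindow x : ℂ) * Complex.exp (-(Complex.I * ((y j * x : ℝ) : ℂ))))]
  congr 1
  · rw [Finset.prod_const, Finset.card_univ, Fintype.card_fin, inv_pow]
  · congr 1
    funext x
    simp only [torusWindowPi, Finset.prod_mul_distrib, ← Complex.exp_sum, Complex.ofReal_prod,
      Complex.ofReal_sum, Finset.mul_sum, Finset.sum_neg_distrib]

theorem torusWindowPiFourier_int {d : ℕ} (k : Fin d → ℤ) :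
    torusWindowPiFourier (fun j => (k j : ℝ)) = if k = 0 then 1 else 0 := by
  simp only [torusWindowPiFourier, torusWindowFourier_int]
  split_ifs with h
  · simp [h]
  · obtain ⟨j, hj⟩ := Function.ne_iff.1 h
    exact Finset.prod_eq_zero (Finset.mem_univ j) (if_neg hj)

theorem exists_norm_torusWindowPiFourier_le (d : ℕ) (r : ℝ) :
    ∃ C : ℝ, 0 ≤ C ∧ ∀ y : Fin d → ℝ, ‖torusWindowPiFourier y‖ ≤ C * korobovWeightPi r y := by
  obtain ⟨C, hC, h⟩ := exists_norm_torusWindowFourier_le r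
  refine ⟨C ^ d, by positivity, fun y => ?_⟩
  rw [torusWindowPiFourier, norm_prod]
  refine (Finset.prod_le_prod (fun _ _ => norm_nonneg _) fun j _ => h (y j)).trans_eq ?_
  simp [Finset.prod_mul_distrib, korobovWeightPi]

end Window

section Poisson

open MeasureTheory

/-- The cell of `x` in the tiling of `ℝ^d` by the cubes `2π z + [0, 2π)^d`. -/
noncomputable def torusCell {d : ℕ} (x : Fin d → ℝ) : Fin d → ℤ := fun j => ⌊x j / (2 * Real.pi)⌋

theorem measurable_torusCell {d : ℕ} : Measurable (torusCell (d := d)) := by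
  refine measurable_pi_lambda _ fun j => ?_
  exact Int.measurable_floor.comp ((measurable_pi_apply j).div_const _)

theorem torusCell_add {d : ℕ} (x : Fin d → ℝ) (z : Fin d → ℤ) :
    torusCell (fun j => x j + z j * (2 * Real.pi)) = torusCell x + z := by
  funext j
  simp only [torusCell, Pi.add_apply]
  rw [add_div, mul_div_cancel_right₀ _ Real.two_pi_pos.ne', Int.floor_add_intCast]

theorem torusCell_preimage_zero (d : ℕ) :
    torusCell (d := d) ⁻¹' {0} = Set.univ.pi fun _ => Set.Ico (0 : ℝ) (2 * Real.pi) := by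
  ext x
  simp only [Set.mem_preimage, Set.mem_singleton_iff, Set.mem_univ_pi, Set.mem_Ico, funext_iff,
    torusCell, Pi.zero_apply, Int.floor_eq_zero_iff]
  refine forall_congr' fun j => and_congr ?_ ?_
  · rw [le_div_iff₀ Real.two_pi_pos, zero_mul]
  · rw [div_lt_one Real.two_pi_pos]

theorem hasSum_setIntegral_torusCell {d : ℕ} {F : (Fin d → ℝ) → ℂ} (hF : Integrable F) :
    HasSum (fun z : Fin d → ℤ => ∫ x in torusCell ⁻¹' {0}, F fun j => x j + z j * (2 * Real.pi))
      (∫ x, F x) := by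
  have hm : ∀ z : Fin d → ℤ, MeasurableSet (torusCell (d := d) ⁻¹' {z}) := fun z =>
    measurable_torusCell (measurableSet_singleton z)
  have hun : (⋃ z : Fin d → ℤ, torusCell (d := d) ⁻¹' {z}) = Set.univ :=
    Set.iUnion_eq_univ_iff.2 fun x => ⟨torusCell x, rfl⟩
  have h := hasSum_integral_iUnion (μ := volume) (f := F) hm
    (fun z z' hzz => Set.disjoint_left.2 fun x hx hx' => hzz (hx.symm.trans hx'))
    hF.integrableOn
  rw [hun, setIntegral_univ] at h
  have hz : ∀ z : Fin d → ℤ, ∫ x in torusCell ⁻¹' {z}, F x =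
      ∫ x in torusCell ⁻¹' {0}, F fun j => x j + z j * (2 * Real.pi) := by
    intro z
    have hmp := measurePreserving_add_right (volume : Measure (Fin d → ℝ))
        (fun j => (z j : ℝ) * (2 * Real.pi))
    rw [← hmp.setIntegral_preimage_emb (measurableEmbedding_addRight _) F]
    congr 2
    ext x
    change torusCell (fun j => x j + z j * (2 * Real.pi)) = z ↔ torusCell x = 0
    rw [torusCell_add, add_eq_right]
  simpa only [hz] using h

theorem volume_restrict_torusCell_zero (d : ℕ) :
    (volume : Measure (Fin d → ℝ)).restrict (torusCell ⁻¹' {0}) = volume.restrict (torusCube d) := by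
  refine Measure.restrict_congr_set ?_
  rw [torusCell_preimage_zero, torusCube_eq_Icc]
  exact Measure.univ_pi_Ico_ae_eq_Icc

/-- The `2π`-periodization of a function on `ℝ^d`. -/
noncomputable def periodization {d : ℕ} (H : (Fin d → ℝ) → ℂ) (u : Fin d → ℝ) : ℂ :=
  ∑' z : Fin d → ℤ, H fun j => u j + z j * (2 * Real.pi)

theorem isTorusPeriodic_periodization {d : ℕ} (H : (Fin d → ℝ) → ℂ) :
    IsTorusPeriodic (periodization H) := by
  intro x z
  rw [periodization, periodization,
    ← (Equiv.addLeft z).tsum_eq fun w : Fin d → ℤ => H fun j => x j + w j * (2 * Real.pi)]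
  refine tsum_congr fun w => ?_
  congr 1
  funext j
  simp only [Equiv.coe_addLeft, Pi.add_apply, Int.cast_add]
  ring

theorem mem_Icc_of_translate_ne_zero {d : ℕ} {H : (Fin d → ℝ) → ℂ} {R ρ : ℝ}
    (hR : ∀ x, H x ≠ 0 → ∀ j, |x j| ≤ R) {u : Fin d → ℝ} (hu : ∀ j, |u j| ≤ ρ) {z : Fin d → ℤ}
    (hz : H (fun j => u j + z j * (2 * Real.pi)) ≠ 0) :
    z ∈ Fintype.piFinset fun _ : Fin d => Finset.Icc (-⌈R + ρ⌉) ⌈R + ρ⌉ := by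
  refine Fintype.mem_piFinset.2 fun j => ?_
  have h1 := hR _ hz j
  have h2 : |(z j : ℝ) * (2 * Real.pi)| ≤ R + ρ := by
    have : (z j : ℝ) * (2 * Real.pi) = (u j + z j * (2 * Real.pi)) - u j := by ring
    rw [this]
    exact (abs_sub _ _).trans (add_le_add h1 (hu j))
  rw [abs_mul, abs_of_pos Real.two_pi_pos] at h2
  have h3 : |(z j : ℝ)| ≤ ⌈R + ρ⌉ := by
    refine le_trans ?_ (Int.le_ceil _)
    nlinarith [abs_nonneg (z j : ℝ), Real.pi_gt_three]
  have h4 : |z j| ≤ ⌈R + ρ⌉ := by exact_mod_cast h3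
  exact Finset.mem_Icc.2 (abs_le.1 h4)

theorem periodization_eq_sum {d : ℕ} {H : (Fin d → ℝ) → ℂ} {R ρ : ℝ}
    (hR : ∀ x, H x ≠ 0 → ∀ j, |x j| ≤ R) {u : Fin d → ℝ} (hu : ∀ j, |u j| ≤ ρ) :
    periodization H u = ∑ z ∈ Fintype.piFinset fun _ : Fin d => Finset.Icc (-⌈R + ρ⌉) ⌈R + ρ⌉,
      H fun j => u j + z j * (2 * Real.pi) :=
  tsum_eq_sum fun z hz => by
    by_contra h
    exact hz (mem_Icc_of_translate_ne_zero hR hu h)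

theorem continuous_periodization {d : ℕ} {H : (Fin d → ℝ) → ℂ} {R : ℝ} (hH : Continuous H)
    (hR : ∀ x, H x ≠ 0 → ∀ j, |x j| ≤ R) : Continuous (periodization H) := by
  refine continuous_iff_continuousAt.2 fun u => ?_
  have hev : ∀ᶠ v in nhds u, periodization H v =
      ∑ z ∈ Fintype.piFinset fun _ : Fin d => Finset.Icc (-⌈R + (‖u‖ + 1)⌉) ⌈R + (‖u‖ + 1)⌉,
        H fun j => v j + z j * (2 * Real.pi) := by
    have : ∀ᶠ v in nhds u, ‖v‖ < ‖u‖ + 1 :=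
      continuous_norm.continuousAt.eventually_lt continuousAt_const (by simp)
    filter_upwards [this] with v hv
    exact periodization_eq_sum hR fun j => (norm_le_pi_norm v j).trans hv.le
  refine ContinuousAt.congr ?_ (hev.mono fun _ h => h.symm)
  exact (continuous_finsetSum _ fun z _ => hH.comp (by fun_prop)).continuousAt

theorem torusFourierCoeff_periodization {d : ℕ} {H : (Fin d → ℝ) → ℂ} {R : ℝ} (hH : Continuous H)
    (hR : ∀ x, H x ≠ 0 → ∀ j, |x j| ≤ R) (w : Fin d → ℤ) :
    torusFourierCoeff (periodization H) w =
      ((2 * Real.pi : ℂ) ^ d)⁻¹ * ∫ x, H x * torusChar (-w) x := by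
  have hc : Continuous fun x => H x * torusChar (-w) x := hH.mul (continuous_torusChar _)
  have hcs : HasCompactSupport fun x => H x * torusChar (-w) x := by
    refine HasCompactSupport.of_support_subset_isCompact
      (isCompact_Icc (a := fun _ : Fin d => -R) (b := fun _ => R)) fun x hx => ?_
    have h := hR x (left_ne_zero_of_mul hx)
    exact ⟨fun j => (abs_le.1 (h j)).1, fun j => (abs_le.1 (h j)).2⟩
  have hs := hasSum_setIntegral_torusCell (hc.integrable_of_hasCompactSupport hcs)
  rw [torusFourierCoeff_eq, integral_torusMeasure, ← volume_restrict_torusCell_zero,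
    Complex.real_smul]
  push_cast
  congr 1
  rw [← hs.tsum_eq]
  have hm : MeasurableSet (torusCell (d := d) ⁻¹' {0}) :=
    measurable_torusCell (measurableSet_singleton 0)
  have hbd : ∀ x ∈ torusCell (d := d) ⁻¹' {0}, ∀ j, |x j| ≤ 2 * Real.pi := by
    intro x hx j
    rw [torusCell_preimage_zero] at hx
    have := hx j trivial
    rw [abs_of_nonneg this.1]
    exact this.2.le
  have hint : ∀ z : Fin d → ℤ, IntegrableOn
      (fun x => H (fun j => x j + z j * (2 * Real.pi)) * torusChar (-w) x)
      (torusCell ⁻¹' {0}) := by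
    intro z
    have hcz : Continuous fun x : Fin d → ℝ =>
        H (fun j => x j + z j * (2 * Real.pi)) * torusChar (-w) x :=
      (hH.comp (by fun_prop)).mul (continuous_torusChar _)
    rw [IntegrableOn, volume_restrict_torusCell_zero]
    exact hcz.continuousOn.integrableOn_compact (isCompact_torusCube d)
  set Z := Fintype.piFinset fun _ : Fin d =>
    Finset.Icc (-⌈R + 2 * Real.pi⌉) ⌈R + 2 * Real.pi⌉ with hZ
  have hper := isTorusPeriodic_torusChar (-w)
  rw [tsum_eq_sum (s := Z)]
  · have hper' : ∀ (x : Fin d → ℝ) (z : Fin d → ℤ),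
        torusChar (-w) (fun j => x j + z j * (2 * Real.pi)) = torusChar (-w) x := hper
    simp only [hper']
    rw [← integral_finsetSum _ fun z _ => hint z]
    refine setIntegral_congr_fun hm fun x hx => ?_
    rw [periodization_eq_sum hR (hbd x hx), Finset.sum_mul]
  · intro z hz
    refine setIntegral_eq_zero_of_forall_eq_zero fun x hx => ?_
    rw [mul_eq_zero]
    left
    by_contra h
    exact hz (mem_Icc_of_translate_ne_zero hR (hbd x hx) h)

/-- **Poisson summation** on `ℝ^d` for continuous compactly supported functions. -/
theorem hasSum_poisson {d : ℕ} {H : (Fin d → ℝ) → ℂ} {R : ℝ} (hH : Continuous H)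
    (hR : ∀ x, H x ≠ 0 → ∀ j, |x j| ≤ R)
    (hs : Summable fun w : Fin d → ℤ => ((2 * Real.pi : ℂ) ^ d)⁻¹ * ∫ x, H x * torusChar (-w) x) :
    HasSum (fun w : Fin d → ℤ => ((2 * Real.pi : ℂ) ^ d)⁻¹ * ∫ x, H x * torusChar (-w) x)
      (∑' z : Fin d → ℤ, H fun j => z j * (2 * Real.pi)) := by
  have hco := torusFourierCoeff_periodization hH hR
  have h := hasSum_torusFourierCoeff (continuous_periodization hH hR)
    (isTorusPeriodic_periodization H) (by rw [funext hco]; exact hs) 0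
  simp only [hco] at h
  simpa [periodization, torusChar] using h

theorem sum_mulVec_mul_mulVec {d : ℕ} {A B : Matrix (Fin d) (Fin d) ℝ} (hBA : B.transpose * A = 1)
    (w u : Fin d → ℝ) : ∑ i, B.mulVec w i * A.mulVec u i = ∑ i, w i * u i := by
  change B.mulVec w ⬝ᵥ A.mulVec u = w ⬝ᵥ u
  rw [Matrix.dotProduct_mulVec, ← Matrix.mulVec_transpose, Matrix.mulVec_mulVec]
  have : A.transpose * B = 1 := by
    rw [← Matrix.transpose_transpose B, ← Matrix.transpose_mul, hBA, Matrix.transpose_one]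
  rw [this, Matrix.one_mulVec]

theorem hasSum_torusWindowPiFourier {d : ℕ} {A B : Matrix (Fin d) (Fin d) ℝ}
    (hBA : B.transpose * A = 1) (k : Fin d → ℤ)
    (hs : Summable fun w : Fin d → ℤ =>
      torusWindowPiFourier fun j => B.mulVec (fun i => (w i : ℝ)) j - k j) :
    HasSum (fun w : Fin d → ℤ => torusWindowPiFourier fun j => B.mulVec (fun i => (w i : ℝ)) j - k j)
      (((|A.det| : ℝ) : ℂ) * ∑' z : Fin d → ℤ,
        (torusWindowPi (A.mulVec fun j => z j * (2 * Real.pi)) : ℂ) *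
          torusChar k (A.mulVec fun j => z j * (2 * Real.pi))) := by
  have hdet : A.det ≠ 0 := by
    intro h
    have := congrArg Matrix.det hBA
    rw [Matrix.det_mul, h, mul_zero, Matrix.det_one] at this
    exact zero_ne_one this
  have habs : ((|A.det| : ℝ) : ℂ) ≠ 0 := by exact_mod_cast (abs_pos.2 hdet).ne'
  set H : (Fin d → ℝ) → ℂ := fun u =>
    (torusWindowPi (A.mulVec u) : ℂ) * torusChar k (A.mulVec u) with hHdef
  have hAc : Continuous fun u : Fin d → ℝ => A.mulVec u := by fun_prop
  have hH : Continuous H :=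
    (Complex.continuous_ofReal.comp (continuous_torusWindowPi.comp hAc)).mul
      ((continuous_torusChar k).comp hAc)
  obtain ⟨R, hR⟩ : ∃ R : ℝ, ∀ u, H u ≠ 0 → ∀ j, |u j| ≤ R := by
    refine ⟨∑ i, ∑ j, |B i j| * (4 * Real.pi), fun u hu j => ?_⟩
    have hw : torusWindowPi (A.mulVec u) ≠ 0 := by
      have := left_ne_zero_of_mul hu
      exact_mod_cast this
    have huj : u j = ∑ i, B i j * A.mulVec u i := by
      have h1 : B.transpose.mulVec (A.mulVec u) = u := by
        rw [Matrix.mulVec_mulVec, hBA, Matrix.one_mulVec]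
      conv_lhs => rw [← h1]
      rfl
    rw [huj]
    refine (Finset.abs_sum_le_sum_abs _ _).trans (Finset.sum_le_sum fun i _ => ?_)
    rw [abs_mul]
    refine (mul_le_mul_of_nonneg_left (abs_le_of_torusWindowPi_ne_zero hw i) (abs_nonneg _)).trans ?_
    exact Finset.single_le_sum (f := fun j => |B i j| * (4 * Real.pi))
      (fun j _ => mul_nonneg (abs_nonneg _) (by positivity)) (Finset.mem_univ j)
  have hcoef : ∀ w : Fin d → ℤ, ((2 * Real.pi : ℂ) ^ d)⁻¹ * ∫ x, H x * torusChar (-w) x =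
      ((|A.det| : ℝ) : ℂ)⁻¹ * torusWindowPiFourier fun j => B.mulVec (fun i => (w i : ℝ)) j - k j := by
    intro w
    set y : Fin d → ℝ := fun j => B.mulVec (fun i => (w i : ℝ)) j - k j with hy
    set G : (Fin d → ℝ) → ℂ := fun x => (torusWindowPi x : ℂ) *
        Complex.exp (-(Complex.I * ((∑ j, y j * x j : ℝ) : ℂ))) with hG
    have hGc : Continuous G :=
      (Complex.continuous_ofReal.comp continuous_torusWindowPi).mul (by fun_prop)
    have hHG : ∀ u, H u * torusChar (-w) u = G (A.mulVec u) := by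
      intro u
      have h1 := sum_mulVec_mul_mulVec hBA (fun i => (w i : ℝ)) u
      simp only [hHdef, hG, torusChar, mul_assoc, ← Complex.exp_add]
      congr 2
      rw [← mul_add, ← mul_neg, ← Complex.ofReal_add, ← Complex.ofReal_neg]
      congr 2
      simp only [hy, sub_mul, Finset.sum_sub_distrib, h1, Pi.neg_apply, Int.cast_neg, neg_mul,
        Finset.sum_neg_distrib]
      ring
    have hmap := Real.map_matrix_volume_pi_eq_smul_volume_pi hdet
    have hint : ∫ u, G (A.mulVec u) = ((|A.det| : ℝ) : ℂ)⁻¹ * ∫ x, G x := by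
      have h2 := integral_map (μ := (volume : Measure (Fin d → ℝ))) (φ := Matrix.toLin' A)
        (by exact hAc.measurable.aemeasurable) (f := G) hGc.aestronglyMeasurable
      rw [hmap, integral_smul_measure, ENNReal.toReal_ofReal (abs_nonneg _)] at h2
      simp only [Matrix.toLin'_apply] at h2
      rw [← h2, Complex.real_smul, abs_inv]
      push_cast
      rfl
    simp only [hHG]
    rw [hint, torusWindowPiFourier_eq_integral]
    ring
  have hp := hasSum_poisson hH hR (by
    simp only [hcoef]
    exact hs.mul_left _)
  simp only [hcoef] at hp
  have hp2 := hp.mul_left ((|A.det| : ℝ) : ℂ)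
  simpa only [mul_inv_cancel_left₀ habs] using hp2

end Poisson

section Frolov

open MeasureTheory

theorem korobovWeightPi_sub_int_le {d : ℕ} {r : ℝ} (hr : 0 ≤ r) (y : Fin d → ℝ) (k : Fin d → ℤ) :
    korobovWeightPi r (fun j => y j - k j) ≤
      (∏ j, (|(k j : ℝ)| + 1) ^ r) * korobovWeightPi r y := by
  simp only [korobovWeightPi, ← Finset.prod_mul_distrib]
  refine Finset.prod_le_prod (fun j _ => (korobovWeight_pos r _).le) fun j _ => ?_
  have hk := abs_nonneg (k j : ℝ)
  refine korobovWeight_le_of_le hr (by linarith) ?_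
  have h1 := le_max_left |y j - k j| 1
  have h2 := le_max_right |y j - k j| 1
  have h3 : |y j| ≤ |y j - k j| + |(k j : ℝ)| := by
    have := abs_add_le (y j - k j) (k j)
    rwa [sub_add_cancel] at this
  exact max_le (by nlinarith) (by nlinarith)

/-- The error of the lattice cubature formula with dual lattice `B ℤ^d` is controlled by the sum of
the Korobov weights over the nonzero dual lattice points. -/
theorem exists_frolov_error_le (d : ℕ) {r : ℝ} (hr : 1 < r) :
    ∃ C : ℝ, 0 ≤ C ∧ ∀ (A B : Matrix (Fin d) (Fin d) ℝ) (S M : ℝ) (Z : Finset (Fin d → ℤ))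
      (g : (Fin d → ℝ) → ℂ), B.transpose * A = 1 → 0 ≤ S → 0 ≤ M →
      (∀ W : Finset (Fin d → ℤ), (∀ w ∈ W, w ≠ 0) →
        ∑ w ∈ W, korobovWeightPi r (B.mulVec fun i => (w i : ℝ)) ≤ S) →
      (∀ z, torusWindowPi (A.mulVec fun j => z j * (2 * Real.pi)) ≠ 0 → z ∈ Z) →
      HasKorobovBound r M g →
      ‖(∫ x, g x ∂torusMeasure d) - ∑ z ∈ Z,
        ((|A.det| * torusWindowPi (A.mulVec fun j => z j * (2 * Real.pi)) : ℝ) : ℂ) *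
          g (A.mulVec fun j => z j * (2 * Real.pi))‖ ≤ C * M * S := by
  obtain ⟨D, hD, hconv⟩ := exists_tsum_korobovWeightPi_conv_le d hr
  obtain ⟨CΦ, hCΦ, hΦ⟩ := exists_norm_torusWindowPiFourier_le d r
  refine ⟨D.toReal * CΦ, by positivity, fun A B S M Z g hBA hS hM hW hZ hg => ?_⟩
  have hKpos := fun y : Fin d → ℝ => (korobovWeightPi_pos r y).le
  set v : (Fin d → ℤ) → Fin d → ℝ := fun w => B.mulVec fun i => (w i : ℝ) with hv
  set X : (Fin d → ℤ) → Fin d → ℝ := fun z => A.mulVec fun j => z j * (2 * Real.pi) with hX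
  set a : (Fin d → ℤ) → ℂ := fun z => ((|A.det| * torusWindowPi (X z) : ℝ) : ℂ) with ha
  have hv0 : v 0 = 0 := by
    simp only [hv, Pi.zero_apply, Int.cast_zero]
    exact Matrix.mulVec_zero B
  have hKsum : Summable fun w => korobovWeightPi r (v w) := by
    refine summable_of_sum_le (c := korobovWeightPi r (v 0) + S) (fun w => hKpos _) fun W => ?_
    have h1 := hW (W.erase 0) fun w hw => Finset.ne_of_mem_erase hw
    by_cases h0 : (0 : Fin d → ℤ) ∈ W
    · rw [← Finset.add_sum_erase _ _ h0]
      gcongr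
    · rw [Finset.erase_eq_of_notMem h0] at h1
      linarith [hKpos (v 0)]
  have hsum : ∀ k : Fin d → ℤ, Summable fun w => torusWindowPiFourier fun j => v w j - k j := by
    intro k
    refine Summable.of_norm_bounded
      ((hKsum.mul_left (∏ j, (|(k j : ℝ)| + 1) ^ r)).mul_left CΦ) fun w => ?_
    exact (hΦ _).trans (mul_le_mul_of_nonneg_left
      (korobovWeightPi_sub_int_le (by linarith) _ _) hCΦ)
  set Q : (Fin d → ℤ) → ℂ := fun k => ∑ z ∈ Z, a z * torusChar k (X z) with hQ
  have hQsum : ∀ k, HasSum (fun w => torusWindowPiFourier fun j => v w j - k j) (Q k) := by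
    intro k
    have h := hasSum_torusWindowPiFourier hBA k (hsum k)
    have h2 : (((|A.det| : ℝ) : ℂ) * ∑' z : Fin d → ℤ,
        (torusWindowPi (X z) : ℂ) * torusChar k (X z)) = Q k := by
      rw [tsum_eq_sum (s := Z), Finset.mul_sum]
      · refine Finset.sum_congr rfl fun z _ => ?_
        simp only [ha]
        push_cast
        ring
      · intro z hz
        have : torusWindowPi (X z) = 0 := by
          by_contra h
          exact hz (hZ z h)
        simp [this]
    rw [← h2]
    exact h
  have hfour0 : ∀ k : Fin d → ℤ, torusWindowPiFourier (fun j => v 0 j - k j) =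
      if k = 0 then 1 else 0 := by
    intro k
    have h := torusWindowPiFourier_int (-k)
    simp only [Pi.neg_apply, Int.cast_neg, neg_eq_zero] at h
    simpa [hv0] using h
  have hdiff : ∀ k : Fin d → ℤ, (Q k - if k = 0 then 1 else 0) =
      ∑' w, if w = 0 then 0 else torusWindowPiFourier fun j => v w j - k j := by
    intro k
    rw [← (hQsum k).tsum_eq, (hsum k).tsum_eq_add_tsum_ite 0, hfour0, add_sub_cancel_left]
  have hgQ : HasSum (fun k => torusFourierCoeff g k * Q k) (∑ z ∈ Z, a z * g (X z)) := by
    have h := hasSum_sum (s := Z) fun z _ =>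
      (hasSum_torusFourierCoeff hg.continuous hg.periodic (hg.summable hr) (X z)).mul_left (a z)
    have he : ∀ k, torusFourierCoeff g k * Q k =
        ∑ z ∈ Z, a z * (torusFourierCoeff g k * torusChar k (X z)) := fun k => by
      rw [hQ, Finset.mul_sum]
      exact Finset.sum_congr rfl fun z _ => by ring
    simp only [he]
    exact h
  have hg0 : HasSum (fun k => torusFourierCoeff g k * if k = 0 then 1 else 0)
      (∫ x, g x ∂torusMeasure d) := by
    rw [← torusFourierCoeff_zero]
    convert hasSum_ite_eq (0 : Fin d → ℤ) (torusFourierCoeff g 0) using 2 with k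
    split_ifs with h
    · rw [h, mul_one]
    · rw [mul_zero]
  have herr := hgQ.sub hg0
  rw [norm_sub_rev, ← herr.tsum_eq]
  have hmain : ‖∑' k, (torusFourierCoeff g k * Q k - torusFourierCoeff g k *
      if k = 0 then 1 else 0)‖ₑ ≤ ENNReal.ofReal (D.toReal * CΦ * M * S) := by
    calc _ ≤ ∑' k, ‖torusFourierCoeff g k * Q k - torusFourierCoeff g k *
            if k = 0 then 1 else 0‖ₑ := enorm_tsum_le_tsum_enorm
      _ ≤ ∑' (k : Fin d → ℤ) (w : Fin d → ℤ), ENNReal.ofReal (M * CΦ) *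
            (if w = 0 then 0 else ENNReal.ofReal (korobovWeightPi r fun j => (k j : ℝ)) *
              ENNReal.ofReal (korobovWeightPi r fun j => v w j - k j)) := by
          refine ENNReal.tsum_le_tsum fun k => ?_
          rw [← mul_sub, hdiff, enorm_mul]
          refine (mul_le_mul_right enorm_tsum_le_tsum_enorm _).trans ?_
          rw [← ENNReal.tsum_mul_left]
          refine ENNReal.tsum_le_tsum fun w => ?_
          split_ifs with hw
          · simp
          · rw [← ofReal_norm, ← ofReal_norm, ← ENNReal.ofReal_mul (norm_nonneg _),
              ← ENNReal.ofReal_mul (hKpos _), ← ENNReal.ofReal_mul (by positivity)]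
            refine ENNReal.ofReal_le_ofReal ?_
            calc _ ≤ _ := mul_le_mul (hg.bound k) (hΦ _) (norm_nonneg _)
                  (mul_nonneg hM (hKpos _))
              _ = _ := by ring
      _ = ENNReal.ofReal (M * CΦ) * ∑' (w : Fin d → ℤ), if w = 0 then 0 else ∑' (k : Fin d → ℤ),
            ENNReal.ofReal (korobovWeightPi r fun j => (k j : ℝ)) *
              ENNReal.ofReal (korobovWeightPi r fun j => v w j - k j) := by
          rw [ENNReal.tsum_comm, ← ENNReal.tsum_mul_left]
          refine tsum_congr fun w => ?_
          rw [ENNReal.tsum_mul_left]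
          split_ifs with hw
          · simp
          · rfl
      _ ≤ ENNReal.ofReal (M * CΦ) * ∑' (w : Fin d → ℤ), D *
            if w = 0 then 0 else ENNReal.ofReal (korobovWeightPi r (v w)) := by
          gcongr with w
          split_ifs with hw
          · simp
          · exact hconv (v w)
      _ ≤ ENNReal.ofReal (M * CΦ) * (D * ENNReal.ofReal S) := by
          rw [ENNReal.tsum_mul_left]
          gcongr
          rw [ENNReal.tsum_eq_iSup_sum]
          refine iSup_le fun W => ?_
          rw [Finset.sum_ite, Finset.sum_const_zero, zero_add,
            ← ENNReal.ofReal_sum_of_nonneg fun w _ => hKpos _]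
          exact ENNReal.ofReal_le_ofReal (hW _ fun w hw => (Finset.mem_filter.1 hw).2)
      _ = _ := by
          nth_rewrite 1 [← ENNReal.ofReal_toReal hD]
          rw [← ENNReal.ofReal_mul ENNReal.toReal_nonneg, ← ENNReal.ofReal_mul (by positivity)]
          congr 1
          ring
  rw [← ofReal_norm] at hmain
  exact (ENNReal.ofReal_le_ofReal_iff (by positivity)).1 hmain

theorem exists_torusCube_translate {d : ℕ} (x : Fin d → ℝ) :
    ∃ z : Fin d → ℤ, (fun j => x j + z j * (2 * Real.pi)) ∈ torusCube d := by
  refine ⟨-torusCell x, ?_⟩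
  have h := torusCell_add x (-torusCell x)
  rw [add_neg_cancel] at h
  have h2 : (fun j => x j + ((-torusCell x) j : ℤ) * (2 * Real.pi)) ∈ torusCell ⁻¹' {0} := h
  rw [torusCell_preimage_zero] at h2
  exact fun j _ => Set.Ico_subset_Icc_self (h2 j trivial)

theorem weightedDiscretizationError_le_of_periodic {d m : ℕ} {q E : ℝ}
    {K : Set ((Fin d → ℝ) → ℂ)} (hK : ∀ f ∈ K, IsTorusPeriodic f) {ι : Type*} (Z : Finset ι)
    (hZ : Z.card ≤ m) (X : ι → Fin d → ℝ) (a : ι → ℝ)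
    (hE : ∀ f ∈ K, |(∫ x, ‖f x‖ ^ q ∂torusMeasure d) - ∑ i ∈ Z, a i * ‖f (X i)‖ ^ q| ≤ E) :
    weightedDiscretizationError (torusCube d) (torusMeasure d) K q m ≤ ENNReal.ofReal E := by
  choose z hz using fun i => exists_torusCube_translate (X i)
  obtain ⟨e⟩ : Nonempty (Z ↪ Fin m) := by
    rw [Function.Embedding.nonempty_iff_card_le]
    simpa using hZ
  refine iInf₂_le_of_le
    (Function.extend e (fun i j => X i j + z i j * (2 * Real.pi)) fun _ _ => 0) (fun j => ?_)
    (iInf_le_of_le (Function.extend e (fun i => a i) 0) (iSup₂_le fun f hf => ?_))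
  · by_cases hj : ∃ i, e i = j
    · obtain ⟨i, rfl⟩ := hj
      rw [e.injective.extend_apply]
      exact hz i
    · rw [Function.extend_apply' _ _ _ hj]
      exact fun _ _ => ⟨le_rfl, Real.two_pi_pos.le⟩
  · refine ENNReal.ofReal_le_ofReal ?_
    convert hE f hf using 3
    rw [← Finset.sum_coe_sort Z fun i => a i * ‖f (X i)‖ ^ q]
    symm
    refine Fintype.sum_of_injective e e.injective _ _ (fun j hj => ?_) fun i => ?_
    · rw [Function.extend_apply' _ _ _ (by simpa using hj)]
      simp
    · simp only [e.injective.extend_apply]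
      rw [hK f hf (X i) (z i)]

end Frolov

section UpperBound

open MeasureTheory

theorem two_rpow_neg_pow_log_le {r : ℝ} (hr : 0 ≤ r) (e : ℕ) {m : ℕ} (hm : 2 ≤ m) :
    ((2 : ℝ) ^ (-r)) ^ Nat.log 2 m * ((Nat.log 2 m : ℝ) + 1) ^ e ≤
      2 ^ r * (2 / Real.log 2) ^ e * ((m : ℝ) ^ (-r) * Real.log m ^ e) := by
  have hm0 : (0 : ℝ) < m := by positivity
  have hlog2 : 0 < Real.log 2 := Real.log_pos one_lt_two
  set S := Nat.log 2 m with hS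
  have h1 : (m : ℝ) / 2 ≤ 2 ^ S := by
    have h := Nat.lt_pow_succ_log_self one_lt_two m
    have h' : (m : ℝ) < 2 ^ (S + 1) := by exact_mod_cast h
    rw [pow_succ] at h'
    linarith
  have h2 : ((2 : ℝ) ^ (-r)) ^ S ≤ 2 ^ r * (m : ℝ) ^ (-r) := by
    rw [Real.rpow_pow_comm zero_le_two]
    refine (Real.rpow_le_rpow_of_nonpos (by positivity) h1 (by linarith)).trans_eq ?_
    rw [Real.div_rpow hm0.le zero_le_two, Real.rpow_neg zero_le_two r, div_inv_eq_mul, mul_comm]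
  have hS1 : (1 : ℝ) ≤ S := by
    have : 1 ≤ S := Nat.log_pos one_lt_two hm
    exact_mod_cast this
  have h3 : (S : ℝ) * Real.log 2 ≤ Real.log m := by
    rw [← Real.log_pow]
    refine Real.log_le_log (by positivity) ?_
    exact_mod_cast Nat.pow_log_le_self 2 (by omega)
  have h4 : (S : ℝ) + 1 ≤ 2 / Real.log 2 * Real.log m := by
    rw [div_mul_eq_mul_div, le_div_iff₀ hlog2]
    nlinarith
  calc _ ≤ (2 ^ r * (m : ℝ) ^ (-r)) * (2 / Real.log 2 * Real.log m) ^ e := by gcongr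
    _ = _ := by rw [mul_pow]; ring

theorem card_cubature_nodes_le {d m : ℕ} (hd : 1 ≤ d) (hm : 1 ≤ m) :
    (Fintype.piFinset fun _ : Fin d => Finset.Icc (-(⌊(m : ℝ) ^ (1 / d : ℝ) / 3⌋₊ : ℤ))
      ⌊(m : ℝ) ^ (1 / d : ℝ) / 3⌋₊).card ≤ m := by
  set t : ℝ := (m : ℝ) ^ (1 / d : ℝ) with ht
  have ht1 : 1 ≤ t := Real.one_le_rpow (by exact_mod_cast hm) (by positivity)
  have htd : t ^ d = m := by
    rw [ht, ← Real.rpow_natCast, ← Real.rpow_mul (by positivity), one_div_mul_cancel, Real.rpow_one]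
    exact_mod_cast (by omega : d ≠ 0)
  set L := ⌊t / 3⌋₊ with hL
  have hL3 : (L : ℝ) ≤ t / 3 := Nat.floor_le (by linarith)
  have hbase : (2 * (L : ℝ) + 1) ≤ t := by
    rcases Nat.eq_zero_or_pos L with h | h
    · rw [h]
      simpa using ht1
    · have : (1 : ℝ) ≤ L := by exact_mod_cast h
      linarith
  have hcard : (Fintype.piFinset fun _ : Fin d => Finset.Icc (-(L : ℤ)) L).card =
      (2 * L + 1) ^ d := by
    rw [Fintype.card_piFinset]
    simp only [Int.card_Icc, Finset.prod_const, Finset.card_univ, Fintype.card_fin]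
    congr 1
    omega
  rw [hcard]
  have : (((2 * L + 1) ^ d : ℕ) : ℝ) ≤ m := by
    push_cast
    rw [← htd]
    gcongr
  exact_mod_cast this

theorem exists_weightedDiscretizationError_le (e : ℕ) {r : ℝ} (hr : 1 < r) {n : ℕ} (hn : 1 ≤ n) :
    ∃ C : ℝ, 0 < C ∧ ∀ m : ℕ, 2 ≤ m →
      weightedDiscretizationError (torusCube (e + 1)) (torusMeasure (e + 1))
        (korobovClass (e + 1) r) (2 * (n : ℝ)) m ≤
        ENNReal.ofReal (C * ((m : ℝ) ^ (-r) * Real.log m ^ e)) := by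
  obtain ⟨B, hdet, hB⟩ := exists_admissible_matrix (Nat.le_add_left 1 e)
  obtain ⟨C₁, hC₁, herr⟩ := exists_frolov_error_le (e + 1) hr
  obtain ⟨M, hM, hpow⟩ := exists_hasKorobovBound_norm_pow (e + 1) hr hn
  set b : ℝ := 1 + ∑ i, ∑ j, |B i j| with hb
  have hb1 : 1 ≤ b := by
    have : 0 ≤ ∑ i, ∑ j, |B i j| :=
      Finset.sum_nonneg fun i _ => Finset.sum_nonneg fun j _ => abs_nonneg _
    linarith
  obtain ⟨a, ha⟩ := pow_unbounded_of_one_lt ((6 * b) ^ (e + 1)) one_lt_two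
  obtain ⟨C₂, hC₂, hlat⟩ := exists_sum_korobovWeightPi_lattice_le e a hr
  have hlog2 : 0 < Real.log 2 := Real.log_pos one_lt_two
  refine ⟨C₁ * M * (C₂ * (2 ^ r * (2 / Real.log 2) ^ e)) + 1, by positivity, fun m hm => ?_⟩
  have hm0 : (0 : ℝ) < m := by positivity
  set t : ℝ := (m : ℝ) ^ (1 / (e + 1 : ℕ) : ℝ) with ht
  have ht0 : 0 < t := Real.rpow_pos_of_pos hm0 _
  have htd : t ^ (e + 1) = m := by
    rw [ht, ← Real.rpow_natCast, ← Real.rpow_mul hm0.le, one_div_mul_cancel, Real.rpow_one]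
    exact_mod_cast e.succ_ne_zero
  set T : ℝ := t / (6 * b) with hT
  have hT0 : 0 < T := by positivity
  set B' : Matrix (Fin (e + 1)) (Fin (e + 1)) ℝ := T • B with hB'
  set A := B'.transpose⁻¹ with hA
  have hBA : B'.transpose * A = 1 := by
    refine Matrix.mul_nonsing_inv _ (isUnit_iff_ne_zero.2 ?_)
    rw [Matrix.det_transpose, hB', Matrix.det_smul]
    exact mul_ne_zero (pow_ne_zero _ hT0.ne') hdet
  set v : (Fin (e + 1) → ℤ) → Fin (e + 1) → ℝ := fun w => B'.mulVec fun i => (w i : ℝ) with hv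
  set S := C₂ * (((2 : ℝ) ^ (-r)) ^ Nat.log 2 m * ((Nat.log 2 m : ℝ) + 1) ^ e) with hS
  have hW := hlat (Nat.log 2 m) (T ^ (e + 1)) v (by
      rw [hT, div_pow, htd, mul_div_assoc', le_div_iff₀ (by positivity), mul_comm]
      have h1 : (2 : ℝ) ^ Nat.log 2 m ≤ m := by
        exact_mod_cast Nat.pow_log_le_self 2 (by omega)
      exact mul_le_mul ha.le h1 (by positivity) (by positivity))
    (fun w w' i => by
      have h1 : (fun i => (((w - w') i : ℤ) : ℝ)) = (fun i => (w i : ℝ)) - fun i => (w' i : ℝ) := by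
        funext i
        simp
      simp only [hv]
      rw [h1, Matrix.mulVec_sub]
      rfl)
    (fun w hw => by
      have h1 : ∀ i, v w i = T * ∑ j, B i j * (w j : ℝ) := by
        intro i
        simp only [hv, hB', Matrix.smul_mulVec, Pi.smul_apply, smul_eq_mul]
        rfl
      simp only [h1, abs_mul, abs_of_pos hT0, Finset.prod_mul_distrib, Finset.prod_const,
        Finset.card_univ, Fintype.card_fin]
      exact le_mul_of_one_le_right (by positivity) (hB w hw))
  set X : (Fin (e + 1) → ℤ) → Fin (e + 1) → ℝ :=
    fun z => A.mulVec fun j => z j * (2 * Real.pi) with hX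
  set L := ⌊t / 3⌋₊ with hL
  have hZ : ∀ z, torusWindowPi (X z) ≠ 0 →
      z ∈ Fintype.piFinset fun _ : Fin (e + 1) => Finset.Icc (-(L : ℤ)) L := by
    intro z hz
    refine Fintype.mem_piFinset.2 fun i => Finset.mem_Icc.2 ?_
    have h1 : (z i : ℝ) * (2 * Real.pi) = ∑ j, T * B j i * X z j := by
      have h2 : B'.transpose.mulVec (X z) = fun j => (z j : ℝ) * (2 * Real.pi) := by
        rw [hX, Matrix.mulVec_mulVec, hBA, Matrix.one_mulVec]
      rw [← congrFun h2 i]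
      rfl
    have h3 : |(z i : ℝ)| * (2 * Real.pi) ≤ T * b * (4 * Real.pi) := by
      rw [← abs_of_pos Real.two_pi_pos, ← abs_mul, h1]
      refine (Finset.abs_sum_le_sum_abs _ _).trans ?_
      calc ∑ j, |T * B j i * X z j| ≤ ∑ j, T * (4 * Real.pi) * |B j i| := by
            refine Finset.sum_le_sum fun j _ => ?_
            rw [abs_mul, abs_mul, abs_of_pos hT0]
            have := mul_le_mul_of_nonneg_left (abs_le_of_torusWindowPi_ne_zero hz j)
              (mul_nonneg hT0.le (abs_nonneg (B j i)))
            linarith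
        _ = T * (4 * Real.pi) * ∑ j, |B j i| := by rw [Finset.mul_sum]
        _ ≤ T * (4 * Real.pi) * b := by
            refine mul_le_mul_of_nonneg_left ?_ (by positivity)
            have : ∑ j, |B j i| ≤ ∑ j, ∑ i, |B j i| := Finset.sum_le_sum fun j _ =>
              Finset.single_le_sum (f := fun i => |B j i|) (fun _ _ => abs_nonneg _)
                (Finset.mem_univ i)
            linarith
        _ = T * b * (4 * Real.pi) := by ring
    have h4 : |(z i : ℝ)| ≤ t / 3 := by
      have h5 : T * b = t / 6 := by
        rw [hT]
        field_simp
      rw [h5] at h3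
      nlinarith [Real.pi_pos]
    have h6 : (z i).natAbs ≤ L := by
      refine Nat.le_floor ?_
      rwa [Nat.cast_natAbs, Int.cast_abs]
    omega
  refine weightedDiscretizationError_le_of_periodic
    (fun f hf => (hasKorobovBound_of_mem_korobovClass hf).periodic) _
    (card_cubature_nodes_le (Nat.le_add_left 1 e) (by omega : 1 ≤ m)) X
    (fun z => |A.det| * torusWindowPi (X z)) fun f hf => ?_
  have hq : ∀ x, ‖f x‖ ^ (2 * (n : ℝ)) = ‖f x‖ ^ (2 * n) := by
    intro x
    rw [← Real.rpow_natCast]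
    push_cast
    rfl
  have h := herr A B' S M _ _ hBA (by positivity) hM hW hZ
    (hpow f (hasKorobovBound_of_mem_korobovClass hf))
  simp only [hq]
  have hcast : ((∫ x, ((‖f x‖ ^ (2 * n) : ℝ) : ℂ) ∂torusMeasure (e + 1)) -
      ∑ z ∈ Fintype.piFinset fun _ : Fin (e + 1) => Finset.Icc (-(L : ℤ)) L,
        ((|A.det| * torusWindowPi (X z) : ℝ) : ℂ) * ((‖f (X z)‖ ^ (2 * n) : ℝ) : ℂ)) =
      (((∫ x, ‖f x‖ ^ (2 * n) ∂torusMeasure (e + 1)) -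
      ∑ z ∈ Fintype.piFinset fun _ : Fin (e + 1) => Finset.Icc (-(L : ℤ)) L,
        (|A.det| * torusWindowPi (X z)) * ‖f (X z)‖ ^ (2 * n) : ℝ) : ℂ) := by
    rw [integral_complex_ofReal]
    push_cast
    rfl
  rw [hcast, Complex.norm_real, Real.norm_eq_abs] at h
  refine h.trans ?_
  have hfin := two_rpow_neg_pow_log_le (by linarith : 0 ≤ r) e hm
  have hpos : 0 ≤ (m : ℝ) ^ (-r) * Real.log m ^ e := by
    have : 0 ≤ Real.log m := Real.log_natCast_nonneg m
    positivity
  calc C₁ * M * S ≤ C₁ * M * (C₂ * (2 ^ r * (2 / Real.log 2) ^ e *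
        ((m : ℝ) ^ (-r) * Real.log m ^ e))) := by
        rw [hS]
        gcongr
    _ = C₁ * M * (C₂ * (2 ^ r * (2 / Real.log 2) ^ e)) * ((m : ℝ) ^ (-r) * Real.log m ^ e) := by
        ring
    _ ≤ _ := mul_le_mul_of_nonneg_right (by linarith) hpos

end UpperBound

section LowerBound

open MeasureTheory

theorem torusFourierCoeff_torusChar {d : ℕ} (l k : Fin d → ℤ) :
    torusFourierCoeff (torusChar l) k = if l = k then 1 else 0 := by
  rw [torusFourierCoeff_eq]
  simp only [← torusChar_add, integral_torusChar, add_neg_eq_zero]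

theorem exists_trigPoly_vanishing {d m : ℕ} (ξ : Fin m → Fin d → ℝ) (J : Finset (Fin d → ℤ))
    (hJ : m < J.card) :
    ∃ a : (Fin d → ℤ) → ℂ, ∑ k ∈ J, ‖a k‖ ^ 2 = 1 ∧
      ∀ j, ∑ k ∈ J, a k * torusChar k (ξ j) = 0 := by
  let Λ : (J → ℂ) →ₗ[ℂ] (Fin m → ℂ) :=
    { toFun := fun b j => ∑ k : J, b k * torusChar k.1 (ξ j)
      map_add' := fun b b' => by
        funext j
        simp [add_mul, Finset.sum_add_distrib]
      map_smul' := fun c b => by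
        funext j
        simp [mul_assoc, Finset.mul_sum] }
  have hker : LinearMap.ker Λ ≠ ⊥ := LinearMap.ker_ne_bot_of_finrank_lt (by simpa using hJ)
  obtain ⟨b, hb, hb0⟩ := (Submodule.ne_bot_iff _).1 hker
  have hbξ : ∀ j, ∑ k : J, b k * torusChar k.1 (ξ j) = 0 := fun j =>
    congrFun (LinearMap.mem_ker.1 hb) j
  set R : ℝ := ∑ k : J, ‖b k‖ ^ 2 with hR
  have hRpos : 0 < R := by
    obtain ⟨k, hk⟩ := Function.ne_iff.1 hb0
    exact Finset.sum_pos' (fun _ _ => by positivity)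
      ⟨k, Finset.mem_univ k, pow_pos (norm_pos_iff.2 hk) 2⟩
  have hsq : 0 < Real.sqrt R := Real.sqrt_pos.2 hRpos
  refine ⟨fun k => if h : k ∈ J then b ⟨k, h⟩ / (Real.sqrt R : ℂ) else 0, ?_, fun j => ?_⟩
  · rw [← Finset.sum_coe_sort]
    simp only [Finset.coe_mem, dite_true, norm_div, Complex.norm_real, Real.norm_of_nonneg hsq.le,
      div_pow, Real.sq_sqrt hRpos.le, ← Finset.sum_div]
    exact div_self hRpos.ne'
  · rw [← Finset.sum_coe_sort]
    simp only [Finset.coe_mem, dite_true, div_mul_eq_mul_div, ← Finset.sum_div]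
    rw [hbξ j, zero_div]

/-- A nonnegative trigonometric polynomial of unit mean, vanishing at given points, with
frequencies in `J - J`. -/
theorem exists_nonneg_trigPoly {d m : ℕ} (ξ : Fin m → Fin d → ℝ) (J : Finset (Fin d → ℤ))
    (hJ : m < J.card) :
    ∃ p : (Fin d → ℝ) → ℝ, Continuous p ∧ IsTorusPeriodic p ∧ (∀ x, 0 ≤ p x) ∧
      (∀ j, p (ξ j) = 0) ∧ ∫ x, p x ∂torusMeasure d = 1 ∧
      (∀ κ, ‖torusFourierCoeff (fun x => (p x : ℂ)) κ‖ ≤ 1) ∧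
      ∀ κ, (∀ k ∈ J, ∀ l ∈ J, k - l ≠ κ) → torusFourierCoeff (fun x => (p x : ℂ)) κ = 0 := by
  obtain ⟨a, ha, hξ⟩ := exists_trigPoly_vanishing ξ J hJ
  set t : (Fin d → ℝ) → ℂ := fun x => ∑ k ∈ J, a k * torusChar k x with ht
  have htc : Continuous t :=
    continuous_finsetSum _ fun k _ => continuous_const.mul (continuous_torusChar k)
  have hpc : Continuous fun x => ‖t x‖ ^ 2 := htc.norm.pow 2
  have hexp : ∀ x, ((‖t x‖ ^ 2 : ℝ) : ℂ) =
      ∑ k ∈ J, ∑ l ∈ J, (a k * (starRingEnd ℂ) (a l)) * torusChar (k - l) x := by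
    intro x
    rw [← Complex.normSq_eq_norm_sq, ← Complex.mul_conj]
    simp only [ht, map_sum, map_mul, Finset.sum_mul_sum, torusChar_sub]
    exact Finset.sum_congr rfl fun k _ => Finset.sum_congr rfl fun l _ => by ring
  have hcoef : ∀ κ, torusFourierCoeff (fun x => ((‖t x‖ ^ 2 : ℝ) : ℂ)) κ =
      ∑ k ∈ J, ∑ l ∈ J, (a k * (starRingEnd ℂ) (a l)) * if k - l = κ then 1 else 0 := by
    intro κ
    have hcont : ∀ k l : Fin d → ℤ, Continuous fun x =>
        (a k * (starRingEnd ℂ) (a l)) * torusChar (k - l) x := fun k l =>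
      continuous_const.mul (continuous_torusChar _)
    simp only [hexp]
    rw [torusFourierCoeff_sum _ fun k _ => continuous_finsetSum _ fun l _ => hcont k l]
    refine Finset.sum_congr rfl fun k _ => ?_
    rw [torusFourierCoeff_sum _ fun l _ => hcont k l]
    refine Finset.sum_congr rfl fun l _ => ?_
    rw [torusFourierCoeff_const_mul]
    congr 1
    exact torusFourierCoeff_torusChar _ _
  have hint : ∫ x, ‖t x‖ ^ 2 ∂torusMeasure d = 1 := by
    have h := hcoef 0
    rw [torusFourierCoeff_zero, integral_complex_ofReal] at h
    have h2 : ∑ k ∈ J, ∑ l ∈ J, (a k * (starRingEnd ℂ) (a l)) * (if k - l = 0 then 1 else 0) =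
        ((∑ k ∈ J, ‖a k‖ ^ 2 : ℝ) : ℂ) := by
      push_cast
      refine Finset.sum_congr rfl fun k hk => ?_
      rw [Finset.sum_eq_single_of_mem k hk fun l _ hl => by
        rw [if_neg (sub_ne_zero.2 hl.symm), mul_zero], sub_self, if_pos rfl, mul_one,
        Complex.mul_conj, Complex.normSq_eq_norm_sq]
      push_cast
      rfl
    rw [h2, ha] at h
    exact_mod_cast h
  refine ⟨fun x => ‖t x‖ ^ 2, hpc, fun x z => ?_, fun x => by positivity, fun j => ?_, hint,
    fun κ => ?_, fun κ hκ => ?_⟩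
  · simp only [ht]
    congr 2
    exact Finset.sum_congr rfl fun k _ => congrArg _ (isTorusPeriodic_torusChar k x z)
  · simp only [ht, hξ j]
    simp
  · refine (norm_torusFourierCoeff_le _ κ).trans_eq ?_
    rw [← hint]
    congr 1
    funext x
    rw [Complex.norm_real, Real.norm_of_nonneg (by positivity)]
  · rw [hcoef]
    exact Finset.sum_eq_zero fun k hk => Finset.sum_eq_zero fun l hl => by
      rw [if_neg (hκ k hk l hl), mul_zero]

theorem pow_le_card_piAntidiag (e N : ℕ) :
    ((N : ℝ) / (e + 1)) ^ e ≤ (Finset.piAntidiag (Finset.univ : Finset (Fin (e + 1))) N).card := by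
  have hcard : (N / (e + 1) + 1) ^ e ≤
      (Finset.piAntidiag (Finset.univ : Finset (Fin (e + 1))) N).card := by
    have h1 : (Fintype.piFinset fun _ : Fin e => Finset.range (N / (e + 1) + 1)).card =
        (N / (e + 1) + 1) ^ e := by simp
    rw [← h1]
    refine Finset.card_le_card_of_injOn
      (fun u => (Fin.cons (N - ∑ i, u i) u : Fin (e + 1) → ℕ)) (fun u hu => ?_)
      fun u _ u' _ h => (Fin.cons_injective2 h).2
    have hle : ∑ i, u i ≤ N := by
      calc ∑ i, u i ≤ ∑ _i : Fin e, N / (e + 1) := Finset.sum_le_sum fun i _ =>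
            Nat.lt_succ_iff.1 (Finset.mem_range.1 (Fintype.mem_piFinset.1 hu i))
        _ = e * (N / (e + 1)) := by simp
        _ ≤ (e + 1) * (N / (e + 1)) := Nat.mul_le_mul_right _ (Nat.le_succ e)
        _ ≤ N := Nat.mul_div_le N (e + 1)
    refine Finset.mem_coe.2 (Finset.mem_piAntidiag.2 ⟨?_, fun i _ => Finset.mem_univ i⟩)
    rw [Fin.sum_univ_succ]
    simp only [Fin.cons_zero, Fin.cons_succ]
    omega
  have h2 : (N : ℝ) / (e + 1) ≤ (N / (e + 1) + 1 : ℕ) := by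
    rw [div_le_iff₀ (by positivity), mul_comm]
    exact_mod_cast (Nat.lt_mul_div_succ N (Nat.succ_pos e)).le
  calc ((N : ℝ) / (e + 1)) ^ e ≤ ((N / (e + 1) + 1 : ℕ) : ℝ) ^ e :=
        pow_le_pow_left₀ (by positivity) h2 e
    _ ≤ _ := by exact_mod_cast hcard

theorem card_filter_piAntidiag_le {d : ℕ} {r : ℝ} (hr : 0 < r) (N : ℕ) (κ : Fin d → ℤ) :
    (((Finset.piAntidiag (Finset.univ : Finset (Fin d)) N).filter
      fun s => ∀ j, |(κ j : ℝ)| < 2 ^ s j).card : ℝ) ≤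
      (((2 : ℝ) ^ (-r)) ^ N)⁻¹ * ((1 - (2 : ℝ) ^ (-r))⁻¹ ^ d * korobovWeightPi r fun j => (κ j : ℝ)) := by
  set q : ℝ := (2 : ℝ) ^ (-r) with hq
  have hq0 : 0 < q := by positivity
  have hq1 : q < 1 := Real.rpow_lt_one_of_one_lt_of_neg one_lt_two (by linarith)
  have hq2 : 0 < (1 - q)⁻¹ := inv_pos.2 (by linarith)
  rw [le_inv_mul_iff₀ (by positivity)]
  set F := (Finset.piAntidiag (Finset.univ : Finset (Fin d)) N).filter
      fun s => ∀ j, |(κ j : ℝ)| < 2 ^ s j with hF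
  calc q ^ N * (F.card : ℝ) = ∑ s ∈ F, ∏ j, q ^ s j := by
        rw [Finset.sum_congr rfl fun s hs => ?_, Finset.sum_const, nsmul_eq_mul, mul_comm]
        rw [Finset.prod_pow_eq_pow_sum,
          (Finset.mem_piAntidiag.1 (Finset.mem_filter.1 hs).1).1]
    _ ≤ ∑ s ∈ Fintype.piFinset fun j => Finset.Ico (dyadicLevel (κ j)) (N + 1), ∏ j, q ^ s j := by
        refine Finset.sum_le_sum_of_subset_of_nonneg (fun s hs => ?_) fun s _ _ =>
          Finset.prod_nonneg fun _ _ => by positivity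
        obtain ⟨h1, h2⟩ := Finset.mem_filter.1 hs
        refine Fintype.mem_piFinset.2 fun j => Finset.mem_Ico.2
          ⟨dyadicLevel_le_of_abs_lt (h2 j), Nat.lt_succ_of_le ?_⟩
        rw [← (Finset.mem_piAntidiag.1 h1).1]
        exact Finset.single_le_sum (f := s) (fun _ _ => Nat.zero_le _) (Finset.mem_univ j)
    _ = ∏ j, ∑ s ∈ Finset.Ico (dyadicLevel (κ j)) (N + 1), q ^ s := by
        rw [Finset.prod_univ_sum]
    _ ≤ ∏ j, ((1 - q)⁻¹ * korobovWeight r (κ j)) := by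
        refine Finset.prod_le_prod (fun _ _ => Finset.sum_nonneg fun _ _ => by positivity)
          fun j _ => ?_
        refine (geom_sum_Ico_le_of_lt_one hq0.le hq1).trans ?_
        rw [div_eq_inv_mul]
        exact mul_le_mul_of_nonneg_left (dyadic_le_korobovWeight hr.le _) hq2.le
    _ = _ := by
        rw [Finset.prod_mul_distrib]
        simp [korobovWeightPi]

/-- A nonnegative function in a multiple of the Korobov class that vanishes at given points and has
large mean. -/
theorem exists_nonneg_vanishing_large_mean {d m N : ℕ} {r : ℝ} (hr : 0 < r) (hN : m < 2 ^ N)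
    (ξ : Fin m → Fin d → ℝ) :
    ∃ g : (Fin d → ℝ) → ℝ, Continuous g ∧ IsTorusPeriodic g ∧ (∀ x, 0 ≤ g x) ∧
      (∀ j, g (ξ j) = 0) ∧
      ∫ x, g x ∂torusMeasure d = (Finset.piAntidiag (Finset.univ : Finset (Fin d)) N).card ∧
      ∀ κ : Fin d → ℤ, ‖torusFourierCoeff (fun x => (g x : ℂ)) κ‖ ≤
        (((2 : ℝ) ^ (-r)) ^ N)⁻¹ *
          ((1 - (2 : ℝ) ^ (-r))⁻¹ ^ d * korobovWeightPi r fun j => (κ j : ℝ)) := by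
  set F := Finset.piAntidiag (Finset.univ : Finset (Fin d)) N with hF
  have hex : ∀ s : Fin d → ℕ, s ∈ F → _ := fun s hs => exists_nonneg_trigPoly ξ
    (Fintype.piFinset fun j => Finset.Ico (0 : ℤ) (2 ^ s j)) (by
      rw [Fintype.card_piFinset]
      have h1 : ∀ j, (Finset.Ico (0 : ℤ) (2 ^ s j)).card = 2 ^ s j := fun j => by
        rw [Int.card_Ico, sub_zero]
        exact_mod_cast Int.toNat_natCast (2 ^ s j)
      simp only [h1]
      rwa [Finset.prod_pow_eq_pow_sum, (Finset.mem_piAntidiag.1 hs).1])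
  choose! p hpc hpper hp0 hpξ hpint hpcoef hpzero using hex
  refine ⟨fun x => ∑ s ∈ F, p s x, continuous_finsetSum _ fun s hs => hpc s hs,
    fun x z => Finset.sum_congr rfl fun s hs => hpper s hs x z,
    fun x => Finset.sum_nonneg fun s hs => hp0 s hs x,
    fun j => Finset.sum_eq_zero fun s hs => hpξ s hs j, ?_, fun κ => ?_⟩
  · rw [integral_finsetSum _ fun s hs => (hpc s hs).integrable_torusMeasure,
      Finset.sum_congr rfl fun s hs => hpint s hs]
    simp
  · refine le_trans ?_ (card_filter_piAntidiag_le hr N κ)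
    simp only [Complex.ofReal_sum]
    rw [torusFourierCoeff_sum (f := fun s x => (p s x : ℂ)) _
        fun s hs => Complex.continuous_ofReal.comp (hpc s hs),
      Finset.card_eq_sum_ones, Finset.sum_filter]
    push_cast
    refine (norm_sum_le _ _).trans (Finset.sum_le_sum fun s hs => ?_)
    split_ifs with h
    · exact hpcoef s hs κ
    · refine (norm_eq_zero.2 (hpzero s hs κ fun k hk l hl hkl => h fun j => ?_)).le
      have hkj := Finset.mem_Ico.1 (Fintype.mem_piFinset.1 hk j)
      have hlj := Finset.mem_Ico.1 (Fintype.mem_piFinset.1 hl j)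
      have h1 : |κ j| < 2 ^ s j := by
        rw [← hkl, Pi.sub_apply, abs_lt]
        constructor <;> linarith [hkj.1, hkj.2, hlj.1, hlj.2]
      exact_mod_cast h1

theorem mem_realKorobovClass_of_real {d : ℕ} {r : ℝ} {h : (Fin d → ℝ) → ℝ} (hc : Continuous h)
    (hper : IsTorusPeriodic h)
    (hb : ∀ k : Fin d → ℤ, ‖torusFourierCoeff (fun x => (h x : ℂ)) k‖ ≤
      korobovWeightPi r fun j => (k j : ℝ)) :
    (fun x => (h x : ℂ)) ∈ realKorobovClass d r := by
  refine ⟨⟨Complex.continuous_ofReal.comp hc, fun x j => ?_, hb⟩, fun x => Complex.ofReal_im _⟩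
  simp only
  congr 1
  rw [← hper x (Pi.single j 1)]
  congr 1
  funext i
  rcases eq_or_ne i j with rfl | hij
  · simp
  · simp [hij]

theorem half_pow_add_le (k : ℕ) {y : ℝ} (hy : 0 ≤ y) :
    (1 / 2 : ℝ) ^ k + (1 / 2) ^ k * (k * 2) * y ≤ (1 / 2 + y) ^ k := by
  have h := one_add_mul_le_pow (by linarith : -2 ≤ 2 * y) k
  have h2 : (1 / 2 + y) ^ k = (1 / 2 : ℝ) ^ k * (1 + 2 * y) ^ k := by
    rw [← mul_pow]
    ring
  rw [h2]
  have h3 := mul_le_mul_of_nonneg_left h (by positivity : (0 : ℝ) ≤ (1 / 2) ^ k)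
  linarith

theorem exists_le_weightedDiscretizationError (e : ℕ) {r : ℝ} (hr : 0 < r) {n : ℕ} (hn : 1 ≤ n) :
    ∃ c : ℝ, 0 < c ∧ ∀ m : ℕ, 2 ≤ m →
      ENNReal.ofReal (c * ((m : ℝ) ^ (-r) * Real.log m ^ e)) ≤
        weightedDiscretizationError (torusCube (e + 1)) (torusMeasure (e + 1))
          (realKorobovClass (e + 1) r) (2 * (n : ℝ)) m := by
  set q : ℝ := (2 : ℝ) ^ (-r) with hq
  have hq0 : 0 < q := by positivity
  have hq1 : q < 1 := Real.rpow_lt_one_of_one_lt_of_neg one_lt_two (by linarith)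
  set D : ℝ := (1 - q)⁻¹ ^ (e + 1) with hD
  have hD0 : 0 < D := pow_pos (inv_pos.2 (by linarith)) _
  set b : ℝ := (1 / 2) ^ (2 * n) * (((2 * n : ℕ) : ℝ) * 2) with hbdef
  have hb : 0 < b := by
    have : (0 : ℝ) < n := by exact_mod_cast hn
    rw [hbdef]
    push_cast
    positivity
  refine ⟨b * ((2 * D)⁻¹ * (q * ((e : ℝ) + 1)⁻¹ ^ e)) / 2, by positivity, fun m hm => ?_⟩
  have hm0 : (0 : ℝ) < m := by positivity
  set N := Nat.log 2 m + 1 with hN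
  have hmN : m < 2 ^ N := Nat.lt_pow_succ_log_self one_lt_two m
  refine le_iInf fun ξ => le_iInf fun _ => le_iInf fun w => ?_
  obtain ⟨g, hgc, hgper, hg0, hgξ, hgint, hgcoef⟩ :=
    exists_nonneg_vanishing_large_mean hr hmN ξ
  set ε : ℝ := (2 * D)⁻¹ * q ^ N with hε
  have hε0 : 0 < ε := by positivity
  have hconst : ∀ k : Fin (e + 1) → ℤ, torusFourierCoeff (fun _ => ((1 / 2 : ℝ) : ℂ)) k =
      ((1 / 2 : ℝ) : ℂ) * if 0 = k then 1 else 0 := by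
    intro k
    rw [← torusFourierCoeff_torusChar, ← torusFourierCoeff_const_mul]
    simp only [torusChar_zero, mul_one]
  have hconst_le : ∀ k : Fin (e + 1) → ℤ,
      ‖torusFourierCoeff (fun _ => ((1 / 2 : ℝ) : ℂ)) k‖ ≤
        1 / 2 * korobovWeightPi r fun j => (k j : ℝ) := by
    intro k
    rw [hconst, norm_mul, Complex.norm_real, Real.norm_of_nonneg (by norm_num)]
    refine mul_le_mul_of_nonneg_left ?_ (by norm_num)
    split_ifs with h
    · subst h
      simp [korobovWeightPi, korobovWeight_zero]
    · simpa using (korobovWeightPi_pos r _).le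
  have hf0 : (fun _ => ((1 / 2 : ℝ) : ℂ)) ∈ realKorobovClass (e + 1) r := by
    refine mem_realKorobovClass_of_real continuous_const (fun _ _ => rfl) fun k => ?_
    refine (hconst_le k).trans ?_
    linarith [korobovWeightPi_pos r fun j => (k j : ℝ)]
  have hf1 : (fun x => ((1 / 2 + ε * g x : ℝ) : ℂ)) ∈ realKorobovClass (e + 1) r := by
    refine mem_realKorobovClass_of_real (continuous_const.add (continuous_const.mul hgc))
      (fun x z => by rw [hgper x z]) fun k => ?_
    simp only [Complex.ofReal_add, Complex.ofReal_mul]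
    have hεg : Continuous fun x => (ε : ℂ) * (g x : ℂ) :=
      continuous_const.mul (Complex.continuous_ofReal.comp hgc)
    rw [torusFourierCoeff_add continuous_const hεg, torusFourierCoeff_const_mul]
    have h1 : ‖(ε : ℂ) * torusFourierCoeff (fun x => (g x : ℂ)) k‖ ≤
        1 / 2 * korobovWeightPi r fun j => (k j : ℝ) := by
      rw [norm_mul, Complex.norm_real, Real.norm_of_nonneg hε0.le]
      have hgk : ‖torusFourierCoeff (fun x => (g x : ℂ)) k‖ ≤
          (q ^ N)⁻¹ * (D * korobovWeightPi r fun j => (k j : ℝ)) := hgcoef k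
      refine (mul_le_mul_of_nonneg_left hgk hε0.le).trans_eq ?_
      have hqN : q ^ N ≠ 0 := by positivity
      rw [hε, mul_inv]
      calc (2⁻¹ * D⁻¹ * q ^ N) * ((q ^ N)⁻¹ * (D * korobovWeightPi r fun j => (k j : ℝ)))
          = 2⁻¹ * (D⁻¹ * D) * (q ^ N * (q ^ N)⁻¹) * korobovWeightPi r fun j => (k j : ℝ) := by ring
        _ = _ := by rw [inv_mul_cancel₀ hD0.ne', mul_inv_cancel₀ hqN]; ring
    refine (norm_add_le _ _).trans ((add_le_add (hconst_le k) h1).trans_eq ?_)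
    ring
  have hpw : ∀ y : ℝ, 0 ≤ y → ‖(y : ℂ)‖ ^ (2 * (n : ℝ)) = y ^ (2 * n) := by
    intro y hy
    rw [Complex.norm_real, Real.norm_of_nonneg hy, ← Real.rpow_natCast]
    push_cast
    rfl
  set W : ℝ := ∑ j, w j * (1 / 2) ^ (2 * n) with hW
  set I₁ : ℝ := ∫ x, (1 / 2 + ε * g x) ^ (2 * n) ∂torusMeasure (e + 1) with hI₁
  have herr0 : (∫ _x, ‖((1 / 2 : ℝ) : ℂ)‖ ^ (2 * (n : ℝ)) ∂torusMeasure (e + 1)) -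
      ∑ j, w j * ‖((1 / 2 : ℝ) : ℂ)‖ ^ (2 * (n : ℝ)) = (1 / 2) ^ (2 * n) - W := by
    rw [hpw _ (by norm_num)]
    simp [hW]
  have herr1 : (∫ x, ‖((1 / 2 + ε * g x : ℝ) : ℂ)‖ ^ (2 * (n : ℝ)) ∂torusMeasure (e + 1)) -
      ∑ j, w j * ‖((1 / 2 + ε * g (ξ j) : ℝ) : ℂ)‖ ^ (2 * (n : ℝ)) = I₁ - W := by
    have hnn : ∀ x, 0 ≤ 1 / 2 + ε * g x := fun x => by
      have := mul_nonneg hε0.le (hg0 x)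
      linarith
    simp only [fun x => hpw _ (hnn x), hgξ, mul_zero, add_zero, hI₁, hW,
      hpw (1 / 2) (by norm_num)]
  have hgap : b * (ε * (Finset.piAntidiag (Finset.univ : Finset (Fin (e + 1))) N).card) ≤
      I₁ - (1 / 2) ^ (2 * n) := by
    have h1 : ∫ x, ((1 / 2) ^ (2 * n) + b * (ε * g x)) ∂torusMeasure (e + 1) ≤ I₁ := by
      refine integral_mono (Continuous.integrable_torusMeasure (by fun_prop))
        (Continuous.integrable_torusMeasure (by fun_prop)) fun x => ?_
      exact half_pow_add_le (2 * n) (mul_nonneg hε0.le (hg0 x))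
    rw [integral_add (integrable_const _) (Continuous.integrable_torusMeasure (by fun_prop)),
      integral_const_mul, integral_const_mul, hgint] at h1
    simp only [integral_const, probReal_univ, one_smul] at h1
    linarith
  set δ : ℝ := b * ((2 * D)⁻¹ * (q * ((e : ℝ) + 1)⁻¹ ^ e)) / 2 *
    ((m : ℝ) ^ (-r) * Real.log m ^ e) with hδ
  have hδle : 2 * δ ≤ I₁ - (1 / 2) ^ (2 * n) := by
    refine le_trans ?_ hgap
    have hlogm : Real.log m ≤ N := by
      have h1 : Real.log m ≤ Real.log ((2 : ℝ) ^ N) :=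
        Real.log_le_log hm0 (by exact_mod_cast hmN.le)
      rw [Real.log_pow] at h1
      have h2 : Real.log 2 ≤ 1 := by linarith [Real.log_two_lt_d9]
      nlinarith [Nat.cast_nonneg (α := ℝ) N]
    have hlog0 : 0 ≤ Real.log m := Real.log_natCast_nonneg m
    have hcard : (Real.log m * ((e : ℝ) + 1)⁻¹) ^ e ≤
        (Finset.piAntidiag (Finset.univ : Finset (Fin (e + 1))) N).card := by
      refine le_trans ?_ (pow_le_card_piAntidiag e N)
      rw [div_eq_mul_inv]
      gcongr
    have hqN : q * (m : ℝ) ^ (-r) ≤ q ^ N := by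
      have h1 : (2 : ℝ) ^ Nat.log 2 m ≤ m := by
        exact_mod_cast Nat.pow_log_le_self 2 (by omega)
      rw [hN, pow_succ, mul_comm q]
      refine mul_le_mul_of_nonneg_right ?_ hq0.le
      rw [hq, Real.rpow_pow_comm zero_le_two]
      exact Real.rpow_le_rpow_of_nonpos (by positivity) h1 (by linarith)
    calc 2 * δ = b * ((2 * D)⁻¹ * (q * (m : ℝ) ^ (-r)) *
          (Real.log m * ((e : ℝ) + 1)⁻¹) ^ e) := by rw [hδ, mul_pow]; ring
      _ ≤ b * ((2 * D)⁻¹ * q ^ N *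
          (Finset.piAntidiag (Finset.univ : Finset (Fin (e + 1))) N).card) := by gcongr
      _ = _ := by rw [hε]
  rcases le_total δ |I₁ - W| with h | h
  · refine le_iSup₂_of_le _ hf1 (ENNReal.ofReal_le_ofReal ?_)
    rw [herr1]
    exact h
  · refine le_iSup₂_of_le _ hf0 (ENNReal.ofReal_le_ofReal ?_)
    rw [herr0]
    have h1 := (abs_le.1 h).2
    refine le_trans ?_ (neg_le_abs _)
    linarith

end LowerBound

theorem mainTheorem6 (d : ℕ) (hd : 1 ≤ d) (r : ℝ) (hr : 1 < r) (n : ℕ) (hn : 1 ≤ n) :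
    ∃ c C : ℝ, 0 < c ∧ 0 < C ∧ ∀ m : ℕ, 2 ≤ m →
      (ENNReal.ofReal (c * ((m : ℝ) ^ (-r) * Real.log m ^ (d - 1))) ≤
          weightedDiscretizationError (torusCube d) (torusMeasure d)
            (korobovClass d r) (2 * (n : ℝ)) m ∧
        weightedDiscretizationError (torusCube d) (torusMeasure d)
            (korobovClass d r) (2 * (n : ℝ)) m ≤
          ENNReal.ofReal (C * ((m : ℝ) ^ (-r) * Real.log m ^ (d - 1)))) ∧
      (ENNReal.ofReal (c * ((m : ℝ) ^ (-r) * Real.log m ^ (d - 1))) ≤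
          weightedDiscretizationError (torusCube d) (torusMeasure d)
            (realKorobovClass d r) (2 * (n : ℝ)) m ∧
        weightedDiscretizationError (torusCube d) (torusMeasure d)
            (realKorobovClass d r) (2 * (n : ℝ)) m ≤
          ENNReal.ofReal (C * ((m : ℝ) ^ (-r) * Real.log m ^ (d - 1)))) := by
  obtain ⟨e, rfl⟩ : ∃ e, d = e + 1 := ⟨d - 1, by omega⟩
  obtain ⟨c, hc, hlow⟩ := exists_le_weightedDiscretizationError e (by linarith : 0 < r) hn
  obtain ⟨C, hC, hupp⟩ := exists_weightedDiscretizationError_le e hr hn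
  have hmono : ∀ m, weightedDiscretizationError (torusCube (e + 1)) (torusMeasure (e + 1))
        (realKorobovClass (e + 1) r) (2 * (n : ℝ)) m ≤
      weightedDiscretizationError (torusCube (e + 1)) (torusMeasure (e + 1))
        (korobovClass (e + 1) r) (2 * (n : ℝ)) m := fun m =>
    iInf_mono fun _ => iInf_mono fun _ => iInf_mono fun _ =>
      biSup_mono fun _ hf => hf.1
  refine ⟨c, C, hc, hC, fun m hm => ?_⟩
  rw [Nat.add_sub_cancel]
  exact ⟨⟨(hlow m hm).trans (hmono m), hupp m hm⟩, hlow m hm, (hmono m).trans (hupp m hm)⟩
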